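/- There is an absolute constant $c>0$ with the following property. Let $w\in W^{2,2}(\mathbb{R}^2)$ be real-valued, let $\psi:\mathbb{R}^2\to\mathbb{R}$ be a locally integrable function that satisfies $$(\Delta-1)\psi=w \ \text{ on } \mathbb{R}^2 \text{ in the sense of distributions},\qquad \lim_{|\mathbf{x}|\to\infty}\psi(\mathbf{x})=0$$ (the limit being taken up to null sets), and let $\mathbf{u}=\nabla^\perp\psi=(-\partial_{x_2}\psi,\partial_{x_1}\psi)$ in the weak sense. Then $w\in L^\infty(\mathbb{R}^2)$, $\mathbf{u}\in W^{1,\infty}(\mathbb{R}^2;\mathbb{R}^2)$, and $$\|\mathbf{u}\|_{W^{1,\infty}}\le c\,\Big(1+\big(1+2\ln^+\|w\|_{W^{2,2}}\big)\,\|w\|_{L^\infty}\Big),$$ where $\ln^+a=\ln a$ if $a\ge1$ and $\ln^+a=0$ otherwise, $\|w\|_{W^{2,2}}^2=\sum_{|\beta|\le2}\|\partial^\beta w\|_{L^2}^2$, and $\|\mathbf{u}\|_{W^{1,\infty}}=\max_{|\beta|\le1}\|\partial^\beta\mathbf{u}\|_{L^\infty}$. -/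

import Mathlib

open MeasureTheory Filter Topology
open scoped ENNReal ContDiff

noncomputable section

namespace ScreenedPoisson

/-- The plane `ℝ²` with its Euclidean norm and Lebesgue measure. -/
abbrev Plane : Type := EuclideanSpace ℝ (Fin 2)

/-- Classical partial derivative of a real function in the `i`-th coordinate direction. -/
def partialDeriv (i : Fin 2) (φ : Plane → ℝ) : Plane → ℝ :=
  fun x => fderiv ℝ φ x (EuclideanSpace.single i 1)

/-- `∂^β φ = ∂₁^{β₁} ∂₂^{β₂} φ` for a multi-index `β = (β₁, β₂)`. -/
def multiDeriv (β : ℕ × ℕ) (φ : Plane → ℝ) : Plane → ℝ :=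
  (partialDeriv 0)^[β.1] ((partialDeriv 1)^[β.2] φ)

/-- Test functions: real, smooth, compactly supported. -/
def IsTest (φ : Plane → ℝ) : Prop :=
  ContDiff ℝ ∞ φ ∧ HasCompactSupport φ

/-- The multi-indices `β` with `|β| ≤ k`. -/
def multiIndices (k : ℕ) : Finset (ℕ × ℕ) :=
  (Finset.range (k + 1) ×ˢ Finset.range (k + 1)).filter (fun β => β.1 + β.2 ≤ k)

section Sobolev

variable {F : Type*} [NormedAddCommGroup F] [NormedSpace ℝ F]

/-- `g` is a weak derivative `∂^β f`; both functions are locally integrable. -/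
def IsWeakDeriv (β : ℕ × ℕ) (f g : Plane → F) : Prop :=
  LocallyIntegrable f volume ∧ LocallyIntegrable g volume ∧
    ∀ φ : Plane → ℝ, IsTest φ →
      ∫ x, multiDeriv β φ x • f x = (-1 : ℝ) ^ (β.1 + β.2) • ∫ x, φ x • g x

open Classical in
/-- The weak derivative `∂^β f` (unique up to a null set), and `0` if there is none. -/
def weakDeriv (β : ℕ × ℕ) (f : Plane → F) : Plane → F :=
  if h : ∃ g, IsWeakDeriv β f g then h.choose else 0

/-- `f ∈ W^{k,p}(ℝ²; F)`, for `1 ≤ p ≤ ∞`. -/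
def MemSobolev (k : ℕ) (p : ℝ≥0∞) (f : Plane → F) : Prop :=
  ∀ β ∈ multiIndices k, ∃ g, IsWeakDeriv β f g ∧ MemLp g p volume

/-- The norm of `W^{k,p}(ℝ²; F)`: `(∑_{|β| ≤ k} ‖∂^β f‖_p ^ p)^{1/p}` for `1 ≤ p < ∞` and
`max_{|β| ≤ k} ‖∂^β f‖_∞` for `p = ∞`. -/
def sobolevNorm (k : ℕ) (p : ℝ≥0∞) (f : Plane → F) : ℝ :=
  (if p = ⊤ then (multiIndices k).sup (fun β => eLpNorm (weakDeriv β f) ⊤ volume)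
    else (∑ β ∈ multiIndices k, eLpNorm (weakDeriv β f) p volume ^ p.toReal)
      ^ (1 / p.toReal)).toReal

end Sobolev

/-- `ψ` is a solution of `(Δ - 1) ψ = w` on `ℝ²` in the sense of distributions that vanishes at
infinity. As `ψ` is defined up to null sets, so is its limit. -/
structure IsSolution (w ψ : Plane → ℝ) : Prop where
  locallyIntegrable : LocallyIntegrable ψ volume
  equation : ∀ φ : Plane → ℝ, IsTest φ →
    ∫ x, ψ x * (Laplacian.laplacian φ x - φ x) = ∫ x, w x * φ x
  tendsto_zero : Tendsto ψ (cocompact Plane ⊓ ae volume) (𝓝 0)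

/-- `u = ∇^⊥ ψ = (-∂₂ ψ, ∂₁ ψ)` in the weak sense. -/
def IsWeakPerpGradient (ψ : Plane → ℝ) (u : Plane → Plane) : Prop :=
  IsWeakDeriv (0, 1) ψ (fun x => -(u x 0)) ∧ IsWeakDeriv (1, 0) ψ (fun x => u x 1)

end ScreenedPoisson

end

/-! The operator `(1 - Δ)⁻¹` is the Laplace transform at 1 of the heat semigroup, so the solution
should be `ψ = -∫₀^∞ e^{-t} e^{tΔ} w dt`. To prove this for a weak solution, the heat kernel itself
is used as a test function: a cutoff argument (`SmoothGauss.integral_secondOrder`) allows it, and it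
gives `d/dt (e^{-t} e^{tΔ} ψ) = e^{-t} e^{tΔ} w` pointwise. Decay of `ψ` removes the boundary term
at `t = ∞`, and letting the lower time limit tend to 0 in the sense of distributions yields the
formula (`integral_mul_eq_neg_timeIntegral`).

Moving derivatives onto the kernel expresses `u` and its first weak derivatives as time integrals
against the first and second derivatives of the heat kernel. With `A = ‖w‖_∞`, the first-order
integrand is at most `2 A t^{-1/2}`, which is integrable against `e^{-t}`, so `u` is bounded by a
multiple of `A`. At second order the same argument gives only `4 A t^{-1}`, which diverges
logarithmically at 0. There the two derivatives are put on `w` instead: Cauchy–Schwarz gives `N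
t^{-1/2}` with `N = ‖w‖_{W^{2,2}}`. Switching between the two bounds at `t = max(1, N)^{-2}` leaves
a bounded piece plus `A` times `1 + 2 ln⁺ N`, up to a constant (`abs_timeIntegral_le_log`).

Boundedness of `w` follows from the same representation, because `w` solves `(Δ - 1) w = f` with `f
= Δw - w` in `L²`, and the heat flow of an `L²` function is `O(t^{-1/2})` pointwise. -/

namespace ScreenedPoisson

/-! ### The heat kernel, its derivatives and the heat equation. -/

/-- The heat kernel of the plane. -/
noncomputable def heat (t : ℝ) (z : Plane) : ℝ :=
  (4 * Real.pi * t)⁻¹ * Real.exp (-(4 * t)⁻¹ * ‖z‖ ^ 2)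

/-- The first partial derivatives of the heat kernel. -/
noncomputable def heatFst (i : Fin 2) (t : ℝ) (z : Plane) : ℝ :=
  -(z i / (2 * t)) * heat t z

/-- The second partial derivatives of the heat kernel. -/
noncomputable def heatSnd (i j : Fin 2) (t : ℝ) (z : Plane) : ℝ :=
  (z i * z j / (4 * t ^ 2) - (if i = j then 1 / (2 * t) else 0)) * heat t z

/-- A Gaussian that dominates the heat kernel and its scaled derivatives. -/
noncomputable def envelope (t : ℝ) (z : Plane) : ℝ :=
  (4 * Real.pi * t)⁻¹ * Real.exp (-(8 * t)⁻¹ * ‖z‖ ^ 2)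

lemma contDiff_heat (t : ℝ) : ContDiff ℝ ∞ (heat t) := by
  unfold heat
  exact contDiff_const.mul (Real.contDiff_exp.comp (contDiff_const.mul (contDiff_norm_sq ℝ)))

lemma contDiff_coord (i : Fin 2) : ContDiff ℝ ∞ (fun z : Plane => z i) :=
  (EuclideanSpace.proj (𝕜 := ℝ) i : Plane →L[ℝ] ℝ).contDiff

lemma contDiff_heatFst (i : Fin 2) (t : ℝ) : ContDiff ℝ ∞ (heatFst i t) := by
  unfold heatFst
  exact (((contDiff_coord i).div_const _).neg).mul (contDiff_heat t)

lemma contDiff_heatSnd (i j : Fin 2) (t : ℝ) : ContDiff ℝ ∞ (heatSnd i j t) := by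
  unfold heatSnd
  exact ((((contDiff_coord i).mul (contDiff_coord j)).div_const _).sub contDiff_const).mul
    (contDiff_heat t)

lemma hasFDerivAt_coord (i : Fin 2) (z : Plane) :
    HasFDerivAt (fun z : Plane => z i) (EuclideanSpace.proj (𝕜 := ℝ) i : Plane →L[ℝ] ℝ) z :=
  (EuclideanSpace.proj (𝕜 := ℝ) i : Plane →L[ℝ] ℝ).hasFDerivAt

lemma partialDeriv_eq_of_hasFDerivAt {f : Plane → ℝ} {f' : Plane → Plane →L[ℝ] ℝ}
    (h : ∀ z, HasFDerivAt f (f' z) z) (i : Fin 2) :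
    partialDeriv i f = fun z => f' z (EuclideanSpace.single i 1) := by
  ext z
  rw [partialDeriv, (h z).fderiv]

lemma partialDeriv_mul {f g : Plane → ℝ} (hf : Differentiable ℝ f) (hg : Differentiable ℝ g)
    (i : Fin 2) :
    partialDeriv i (fun z => f z * g z) =
      fun z => f z * partialDeriv i g z + partialDeriv i f z * g z := by
  rw [partialDeriv_eq_of_hasFDerivAt
    (f := fun z => f z * g z) (fun z => (hf z).hasFDerivAt.mul (hg z).hasFDerivAt)]
  ext z
  simp [partialDeriv, mul_comm]

lemma partialDeriv_add {f g : Plane → ℝ} (hf : Differentiable ℝ f) (hg : Differentiable ℝ g)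
    (i : Fin 2) :
    partialDeriv i (fun z => f z + g z) = fun z => partialDeriv i f z + partialDeriv i g z := by
  rw [partialDeriv_eq_of_hasFDerivAt
    (f := fun z => f z + g z) (fun z => (hf z).hasFDerivAt.add (hg z).hasFDerivAt)]
  ext z
  simp [partialDeriv]

lemma partialDeriv_comp_sub (f : Plane → ℝ) (x : Plane) (i : Fin 2) :
    partialDeriv i (fun y => f (y - x)) = fun y => partialDeriv i f (y - x) := by
  ext z
  simp only [partialDeriv, fderiv_comp_sub]

lemma contDiff_partialDeriv {f : Plane → ℝ} (hf : ContDiff ℝ ∞ f) (i : Fin 2) :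
    ContDiff ℝ ∞ (partialDeriv i f) := by
  unfold partialDeriv
  exact (hf.fderiv_right (m := ∞) (by simp)).clm_apply contDiff_const

lemma partialDeriv_coord (i j : Fin 2) :
    partialDeriv j (fun z : Plane => z i) = fun _ => if i = j then 1 else 0 := by
  rw [partialDeriv_eq_of_hasFDerivAt (hasFDerivAt_coord i)]
  ext z
  simp

lemma partialDeriv_heat (i : Fin 2) (t : ℝ) : partialDeriv i (heat t) = heatFst i t := by
  have h (z : Plane) := (((hasStrictFDerivAt_norm_sq z).hasFDerivAt.const_mul
    (-(4 * t)⁻¹)).exp).const_mul (4 * Real.pi * t)⁻¹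
  have := partialDeriv_eq_of_hasFDerivAt h i
  unfold heat
  rw [this]
  ext z
  -- Inversion of 0 makes both sides vanish at `t = 0`, so no condition on `t` is needed.
  by_cases ht : t = 0
  · simp [heatFst, heat, ht]
  simp [heatFst, heat, EuclideanSpace.inner_single_right]
  field_simp
  ring

lemma partialDeriv_heatFst (i j : Fin 2) (t : ℝ) :
    partialDeriv j (heatFst i t) = heatSnd i j t := by
  have h1 : heatFst i t = fun z => z i * ((-(2 * t)⁻¹) * heat t z) := by
    ext z; simp [heatFst]; ring
  have hd : Differentiable ℝ (heat t) := (contDiff_heat t).differentiable (by simp)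
  rw [h1, partialDeriv_mul ((contDiff_coord i).differentiable (by simp)) (hd.const_mul _),
    partialDeriv_mul (differentiable_const _) hd, partialDeriv_coord, partialDeriv_heat]
  ext z
  simp only [heatFst, heatSnd, partialDeriv, fderiv_fun_const]
  by_cases ht : t = 0
  · simp [ht]
  split_ifs <;> simp <;> field_simp <;> ring

lemma hasDerivAt_heat {t : ℝ} (ht : 0 < t) (z : Plane) :
    HasDerivAt (fun s => heat s z) (heatSnd 0 0 t z + heatSnd 1 1 t z) t := by
  have h1 : HasDerivAt (fun s : ℝ => (4 * Real.pi * s)⁻¹)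
      (-(4 * Real.pi) / (4 * Real.pi * t) ^ 2) t := by
    exact (((hasDerivAt_id t).const_mul (4 * Real.pi)).fun_inv
      (mul_pos (by positivity) ht).ne').congr_deriv (by simp)
  have h2 : HasDerivAt (fun s : ℝ => (4 * s)⁻¹) (-4 / (4 * t) ^ 2) t := by
    exact (((hasDerivAt_id t).const_mul (4 : ℝ)).fun_inv
      (mul_pos (by positivity) ht).ne').congr_deriv (by simp)
  have h := h1.mul ((h2.neg.mul_const (‖z‖ ^ 2)).exp)
  refine h.congr_deriv ?_
  have hn : ‖z‖ ^ 2 = z 0 ^ 2 + z 1 ^ 2 := by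
    simp [EuclideanSpace.norm_sq_eq]
  simp only [heatSnd, heat, if_true, hn, Pi.neg_apply]
  field_simp
  ring

/-! ### Gaussian bounds for the kernels, and their integrals. -/

lemma heat_nonneg {t : ℝ} (ht : 0 < t) (z : Plane) : 0 ≤ heat t z := by
  unfold heat; positivity

lemma envelope_nonneg {t : ℝ} (ht : 0 < t) (z : Plane) : 0 ≤ envelope t z := by
  unfold envelope; positivity

lemma abs_coord_le_norm (z : Plane) (i : Fin 2) : |z i| ≤ ‖z‖ := by
  simpa using PiLp.norm_apply_le z i

lemma heat_eq_envelope {t : ℝ} (ht : 0 < t) (z : Plane) :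
    heat t z = envelope t z * Real.exp (-((8 * t)⁻¹ * ‖z‖ ^ 2)) := by
  unfold heat envelope
  rw [mul_assoc _ (Real.exp _), ← Real.exp_add]
  congr 2
  field_simp
  ring

/-- Half of the exponent of the heat kernel pays for a quadratic factor, by `1 + q ≤ e^q` with `q =
‖z‖² / (8t)`; the other half remains as the envelope. -/
lemma abs_mul_heat_le {t a c : ℝ} (ht : 0 < t) (z : Plane)
    (h : |a| ≤ c * (1 + (8 * t)⁻¹ * ‖z‖ ^ 2)) (hc : 0 ≤ c) :
    |a * heat t z| ≤ c * envelope t z := by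
  rw [heat_eq_envelope ht, abs_mul, abs_of_nonneg (mul_nonneg (envelope_nonneg ht z)
    (Real.exp_pos _).le), Real.exp_neg]
  have h1 : |a| ≤ c * Real.exp ((8 * t)⁻¹ * ‖z‖ ^ 2) :=
    h.trans (mul_le_mul_of_nonneg_left (by linarith [Real.add_one_le_exp ((8 * t)⁻¹ * ‖z‖ ^ 2)]) hc)
  calc |a| * (envelope t z * (Real.exp ((8 * t)⁻¹ * ‖z‖ ^ 2))⁻¹)
      ≤ (c * Real.exp ((8 * t)⁻¹ * ‖z‖ ^ 2)) *
        (envelope t z * (Real.exp ((8 * t)⁻¹ * ‖z‖ ^ 2))⁻¹) :=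
        mul_le_mul_of_nonneg_right h1 (mul_nonneg (envelope_nonneg ht z) (by positivity))
    _ = c * envelope t z := by field_simp

lemma abs_heat_le {t : ℝ} (ht : 0 < t) (z : Plane) : |heat t z| ≤ envelope t z := by
  have := abs_mul_heat_le (a := 1) (c := 1) ht z (by
    rw [abs_one, one_mul]; have : 0 ≤ (8 * t)⁻¹ * ‖z‖ ^ 2 := by positivity
    linarith) zero_le_one
  simpa using this

lemma abs_heatFst_le (i : Fin 2) {t : ℝ} (ht : 0 < t) (z : Plane) :
    |heatFst i t z| ≤ (√t)⁻¹ * envelope t z := by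
  have hs : 0 < √t := Real.sqrt_pos.2 ht
  have hst : √t ^ 2 = t := Real.sq_sqrt ht.le
  refine abs_mul_heat_le ht z ?_ (by positivity)
  rw [abs_neg, abs_div, abs_of_pos (by positivity : 0 < 2 * t)]
  have h1 := abs_coord_le_norm z i
  set r := ‖z‖
  refine (div_le_div_of_nonneg_right h1 (by positivity)).trans ?_
  rw [← hst] at *
  set s := √t
  rw [show √(s ^ 2) = s from Real.sqrt_sq hs.le]
  -- Completing the square in `r` shows that the gap is nonnegative.
  have : s⁻¹ * (1 + (8 * s ^ 2)⁻¹ * r ^ 2) - r / (2 * s ^ 2)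
    = ((r - 2 * s) ^ 2 + 4 * s ^ 2) / (8 * s ^ 3) := by field_simp; ring
  have h2 : 0 ≤ ((r - 2 * s) ^ 2 + 4 * s ^ 2) / (8 * s ^ 3) := by positivity
  linarith

lemma abs_heatSnd_le (i j : Fin 2) {t : ℝ} (ht : 0 < t) (z : Plane) :
    |heatSnd i j t z| ≤ 2 * t⁻¹ * envelope t z := by
  refine abs_mul_heat_le ht z ?_ (by positivity)
  have h1 := abs_coord_le_norm z i
  have h2 := abs_coord_le_norm z j
  have h3 : |z i * z j / (4 * t ^ 2)| ≤ ‖z‖ ^ 2 / (4 * t ^ 2) := by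
    rw [abs_div, abs_of_pos (by positivity : 0 < 4 * t ^ 2), abs_mul, sq ‖z‖]
    gcongr
  have h4 : |(if i = j then 1 / (2 * t) else 0)| ≤ 1 / (2 * t) := by
    split_ifs
    · rw [abs_of_pos (by positivity)]
    · simp; positivity
  refine (abs_sub _ _).trans ((add_le_add h3 h4).trans ?_)
  have : 2 * t⁻¹ * (1 + (8 * t)⁻¹ * ‖z‖ ^ 2) - (‖z‖ ^ 2 / (4 * t ^ 2) + 1 / (2 * t))
    = 3 / (2 * t) := by field_simp; ring
  have h5 : 0 ≤ 3 / (2 * t) := by positivity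
  linarith

lemma integral_gaussian {b : ℝ} (hb : 0 < b) :
    ∫ z : Plane, Real.exp (-b * ‖z‖ ^ 2) = Real.pi / b := by
  simpa using GaussianFourier.integral_rexp_neg_mul_sq_norm (V := Plane) hb

lemma integrable_gaussian {b : ℝ} (hb : 0 < b) :
    Integrable (fun z : Plane => Real.exp (-b * ‖z‖ ^ 2)) :=
  Integrable.of_integral_ne_zero (by rw [integral_gaussian hb]; positivity)

lemma integrable_envelope {t : ℝ} (ht : 0 < t) : Integrable (envelope t) :=
  (integrable_gaussian (b := (8 * t)⁻¹) (by positivity)).const_mul _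

lemma integral_envelope {t : ℝ} (ht : 0 < t) : ∫ z, envelope t z = 2 := by
  unfold envelope
  rw [integral_const_mul, integral_gaussian (by positivity)]
  field_simp
  norm_num

lemma integral_heat_sq {t : ℝ} (ht : 0 < t) : ∫ z, heat t z ^ 2 = (8 * Real.pi * t)⁻¹ := by
  have h : ∀ z, heat t z ^ 2 = (4 * Real.pi * t)⁻¹ ^ 2 * Real.exp (-(2 * t)⁻¹ * ‖z‖ ^ 2) := by
    intro z
    rw [heat, mul_pow, ← Real.exp_nat_mul]
    congr 2
    field_simp
    push_cast
    ring
  simp_rw [h]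
  rw [integral_const_mul, integral_gaussian (by positivity)]
  field_simp
  norm_num

lemma memLp_heat {t : ℝ} (ht : 0 < t) : MemLp (heat t) 2 volume := by
  rw [memLp_two_iff_integrable_sq (contDiff_heat t).continuous.aestronglyMeasurable]
  exact Integrable.of_integral_ne_zero (by rw [integral_heat_sq ht]; positivity)

/-! ### Functions of moderate growth, and kernels with Gaussian decay. -/

/-- Functions that are integrable against every Gaussian. -/
def Tame (h : Plane → ℝ) : Prop :=
  ∀ b : ℝ, 0 < b → Integrable (fun y => Real.exp (-b * ‖y‖ ^ 2) * h y)

/-- Functions dominated by some Gaussian. -/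
def GaussBdd (f : Plane → ℝ) : Prop :=
  ∃ b : ℝ, 0 < b ∧ ∃ C : ℝ, 0 ≤ C ∧ ∀ z, |f z| ≤ C * Real.exp (-b * ‖z‖ ^ 2)

/-- From `‖y‖² ≤ 2‖y - x‖² + 2‖x‖²`: recentring a Gaussian costs half of its rate and a constant
depending on the shift. -/
lemma exp_sub_le {b : ℝ} (hb : 0 < b) (x y : Plane) :
    Real.exp (-b * ‖y - x‖ ^ 2) ≤
      Real.exp (b * ‖x‖ ^ 2) * Real.exp (-(b / 2) * ‖y‖ ^ 2) := by
  rw [← Real.exp_add, Real.exp_le_exp]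
  have h1 : ‖y‖ ≤ ‖y - x‖ + ‖x‖ := by simpa using norm_add_le (y - x) x
  have h2 : ‖y‖ ^ 2 ≤ 2 * ‖y - x‖ ^ 2 + 2 * ‖x‖ ^ 2 := by
    have := pow_le_pow_left₀ (norm_nonneg y) h1 2
    nlinarith [sq_nonneg (‖y - x‖ - ‖x‖)]
  nlinarith

lemma GaussBdd.comp_sub {f : Plane → ℝ} (hf : GaussBdd f) (x : Plane) :
    GaussBdd (fun y => f (y - x)) := by
  obtain ⟨b, hb, C, hC, h⟩ := hf
  refine ⟨b / 2, by positivity, C * Real.exp (b * ‖x‖ ^ 2), by positivity, fun z => ?_⟩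
  rw [mul_assoc]
  exact (h _).trans (mul_le_mul_of_nonneg_left (exp_sub_le hb x z) hC)

lemma GaussBdd.of_envelope {f : Plane → ℝ} {t c : ℝ} (ht : 0 < t) (hc : 0 ≤ c)
    (h : ∀ z, |f z| ≤ c * envelope t z) : GaussBdd f :=
  ⟨(8 * t)⁻¹, by positivity, c * (4 * Real.pi * t)⁻¹, by positivity,
    fun z => by rw [mul_assoc]; exact h z⟩

lemma gaussBdd_heat {t : ℝ} (ht : 0 < t) : GaussBdd (heat t) :=
  .of_envelope ht zero_le_one (fun z => by simpa using abs_heat_le ht z)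

lemma gaussBdd_heatFst (i : Fin 2) {t : ℝ} (ht : 0 < t) : GaussBdd (heatFst i t) :=
  .of_envelope ht (by positivity) (abs_heatFst_le i ht)

lemma gaussBdd_heatSnd (i j : Fin 2) {t : ℝ} (ht : 0 < t) : GaussBdd (heatSnd i j t) :=
  .of_envelope ht (by positivity) (abs_heatSnd_le i j ht)

lemma Tame.aestronglyMeasurable {h : Plane → ℝ} (hh : Tame h) :
    AEStronglyMeasurable h volume := by
  have h1 := (hh 1 one_pos).aestronglyMeasurable
  have h2 : Continuous (fun y : Plane => Real.exp (1 * ‖y‖ ^ 2)) := by fun_prop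
  refine (h2.aestronglyMeasurable.mul h1).congr (ae_of_all _ fun y => ?_)
  simp [← mul_assoc, ← Real.exp_add]

lemma Tame.integrable_mul {h f : Plane → ℝ} (hh : Tame h) (hf : GaussBdd f)
    (hc : Continuous f) : Integrable (fun y => f y * h y) := by
  obtain ⟨b, hb, C, hC, hle⟩ := hf
  refine ((hh b hb).const_mul C).mono (hc.aestronglyMeasurable.mul hh.aestronglyMeasurable)
    (ae_of_all _ fun y => ?_)
  rw [norm_mul, norm_mul, norm_mul, ← mul_assoc, Real.norm_eq_abs C, abs_of_nonneg hC,
    Real.norm_eq_abs (Real.exp _), Real.abs_exp]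
  exact mul_le_mul_of_nonneg_right (hle y) (norm_nonneg _)

lemma tame_of_memLp {h : Plane → ℝ} (hh : MemLp h 2 volume) : Tame h := by
  intro b hb
  have hc : Continuous (fun y : Plane => Real.exp (-b * ‖y‖ ^ 2)) := by fun_prop
  have : MemLp (fun y : Plane => Real.exp (-b * ‖y‖ ^ 2)) 2 volume := by
    rw [memLp_two_iff_integrable_sq hc.aestronglyMeasurable]
    refine (integrable_gaussian (b := 2 * b) (by positivity)).congr (ae_of_all _ fun y => ?_)
    simp only [← Real.exp_nat_mul]
    congr 1
    push_cast
    ring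
  exact this.integrable_mul hh

/-- Off a compact set `|ψ| < 1` almost everywhere, and on it `ψ` is integrable. This is all that the
argument needs from decay at infinity: it makes `ψ` tame and controls its heat flow for large times.
-/
lemma exists_dominating {ψ : Plane → ℝ} (h1 : LocallyIntegrable ψ volume)
    (h2 : Tendsto ψ (cocompact Plane ⊓ ae volume) (𝓝 0)) :
    ∃ f : Plane → ℝ, Integrable f ∧ (∀ y, 0 ≤ f y) ∧ ∀ᵐ y, |ψ y| ≤ f y + 1 := by
  have h3 : ∀ᶠ y in cocompact Plane ⊓ ae volume, |ψ y| < 1 := by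
    have := h2.abs
    rw [abs_zero] at this
    exact this.eventually (gt_mem_nhds one_pos)
  rw [Filter.eventually_iff, Filter.mem_inf_iff] at h3
  obtain ⟨s, hs, t, ht, hst⟩ := h3
  obtain ⟨K, hK, hKs⟩ := Filter.mem_cocompact.1 hs
  refine ⟨K.indicator (fun y => |ψ y|),
    IntegrableOn.integrable_indicator (Integrable.abs (h1.integrableOn_isCompact hK))
      hK.measurableSet,
    fun y => Set.indicator_nonneg (fun _ _ => abs_nonneg _) y, ?_⟩
  filter_upwards [ht] with y hy
  by_cases hyK : y ∈ K
  · rw [Set.indicator_of_mem hyK]; linarith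
  · rw [Set.indicator_of_notMem hyK, zero_add]
    have : y ∈ s ∩ t := ⟨hKs hyK, hy⟩
    rw [← hst] at this
    exact le_of_lt this

lemma tame_of_dominated {ψ f : Plane → ℝ} (h1 : AEStronglyMeasurable ψ volume)
    (hf : Integrable f) (h : ∀ᵐ y, |ψ y| ≤ f y + 1) : Tame ψ := by
  intro b hb
  have hc : Continuous (fun y : Plane => Real.exp (-b * ‖y‖ ^ 2)) := by fun_prop
  refine (hf.norm.add (integrable_gaussian hb)).mono' (hc.aestronglyMeasurable.mul h1) ?_
  filter_upwards [h] with y hy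
  have h3 : Real.exp (-b * ‖y‖ ^ 2) ≤ 1 := by
    rw [Real.exp_le_one_iff]; nlinarith [sq_nonneg ‖y‖]
  rw [norm_mul, Real.norm_eq_abs, Real.abs_exp, Real.norm_eq_abs]
  simp only [Pi.add_apply, Real.norm_eq_abs]
  calc Real.exp (-b * ‖y‖ ^ 2) * |ψ y| ≤ Real.exp (-b * ‖y‖ ^ 2) * (|f y| + 1) :=
        mul_le_mul_of_nonneg_left (hy.trans (by linarith [le_abs_self (f y)])) (Real.exp_pos _).le
    _ ≤ |f y| + Real.exp (-b * ‖y‖ ^ 2) := by nlinarith [abs_nonneg (f y)]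

/-! ### Enlarging the class of test functions to include the heat kernel. -/

/-- Smooth functions whose partial derivatives up to order two are dominated by a Gaussian. -/
structure SmoothGauss (f : Plane → ℝ) : Prop where
  contDiff : ContDiff ℝ ∞ f
  bound : GaussBdd f
  bound_fst : ∀ i, GaussBdd (partialDeriv i f)
  bound_snd : ∀ i j, GaussBdd (partialDeriv i (partialDeriv j f))

lemma smoothGauss_heat {t : ℝ} (ht : 0 < t) (x : Plane) :
    SmoothGauss (fun y => heat t (y - x)) where
  contDiff := (contDiff_heat t).comp (contDiff_id.sub contDiff_const)
  bound := (gaussBdd_heat ht).comp_sub x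
  bound_fst i := by
    rw [partialDeriv_comp_sub, partialDeriv_heat]
    exact (gaussBdd_heatFst i ht).comp_sub x
  bound_snd i j := by
    rw [partialDeriv_comp_sub, partialDeriv_heat, partialDeriv_comp_sub, partialDeriv_heatFst]
    exact (gaussBdd_heatSnd j i ht).comp_sub x

lemma GaussBdd.exists_common {ι : Type*} (s : Finset ι) {f : ι → Plane → ℝ}
    (hf : ∀ i ∈ s, GaussBdd (f i)) :
    ∃ b : ℝ, 0 < b ∧ ∃ C : ℝ, 0 ≤ C ∧ ∀ i ∈ s, ∀ z, |f i z| ≤ C * Real.exp (-b * ‖z‖ ^ 2) := by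
  classical
  induction s using Finset.induction_on with
  | empty => exact ⟨1, one_pos, 0, le_rfl, by simp⟩
  | insert i s hi ih =>
    obtain ⟨b, hb, C, hC, h⟩ := ih (fun j hj => hf j (Finset.mem_insert_of_mem hj))
    obtain ⟨b', hb', C', hC', h'⟩ := hf i (Finset.mem_insert_self i s)
    have hm1 : ∀ z : Plane, Real.exp (-b * ‖z‖ ^ 2) ≤ Real.exp (-(min b b') * ‖z‖ ^ 2) := by
      intro z; rw [Real.exp_le_exp]; gcongr; exact min_le_left _ _
    have hm2 : ∀ z : Plane, Real.exp (-b' * ‖z‖ ^ 2) ≤ Real.exp (-(min b b') * ‖z‖ ^ 2) := by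
      intro z; rw [Real.exp_le_exp]; gcongr; exact min_le_right _ _
    refine ⟨min b b', lt_min hb hb', C + C', by positivity, fun j hj z => ?_⟩
    have hE := Real.exp_pos (-(min b b') * ‖z‖ ^ 2)
    rcases Finset.mem_insert.1 hj with rfl | hj
    · refine (h' z).trans ?_
      nlinarith [mul_le_mul_of_nonneg_left (hm2 z) hC', mul_nonneg hC hE.le]
    · refine (h j hj z).trans ?_
      nlinarith [mul_le_mul_of_nonneg_left (hm1 z) hC, mul_nonneg hC' hE.le]

lemma partialDeriv_comp_smul {f : Plane → ℝ} (hf : Differentiable ℝ f) (c : ℝ) (i : Fin 2) :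
    partialDeriv i (fun y => f (c • y)) = fun y => c * partialDeriv i f (c • y) := by
  ext y
  have h : HasFDerivAt (fun y : Plane => f (c • y))
      ((fderiv ℝ f (c • y)).comp (c • ContinuousLinearMap.id ℝ Plane)) y :=
    (hf (c • y)).hasFDerivAt.comp y ((hasFDerivAt_id y).const_smul c)
  simp [partialDeriv, h.fderiv]

lemma hasCompactSupport_partialDeriv {f : Plane → ℝ} (hf : HasCompactSupport f) (i : Fin 2) :
    HasCompactSupport (partialDeriv i f) :=
  hf.fderiv_apply (𝕜 := ℝ) _

lemma IsTest.partialDeriv {φ : Plane → ℝ} (hφ : IsTest φ) (i : Fin 2) :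
    IsTest (partialDeriv i φ) :=
  ⟨contDiff_partialDeriv hφ.1 i, hasCompactSupport_partialDeriv hφ.2 i⟩

lemma IsTest.exists_bound {φ : Plane → ℝ} (hφ : IsTest φ) : ∃ C : ℝ, 0 ≤ C ∧ ∀ y, |φ y| ≤ C := by
  obtain ⟨C, hC⟩ := hφ.2.exists_bound_of_continuous hφ.1.continuous
  exact ⟨C, (abs_nonneg _).trans (hC 0), hC⟩

lemma partialDeriv_congr {f g : Plane → ℝ} {y : Plane} (h : f =ᶠ[𝓝 y] g) (i : Fin 2) :
    partialDeriv i f =ᶠ[𝓝 y] partialDeriv i g := by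
  filter_upwards [h.fderiv (𝕜 := ℝ)] with z hz
  simp [partialDeriv, hz]

/-- Smooth Gaussian-dominated functions are limits of test functions, with domination. -/
lemma SmoothGauss.exists_approx {f : Plane → ℝ} (hf : SmoothGauss f) :
    ∃ φ : ℕ → Plane → ℝ, (∀ n, IsTest (φ n)) ∧ (∀ y, ∀ᶠ n in atTop, φ n =ᶠ[𝓝 y] f) ∧
      ∃ b : ℝ, 0 < b ∧ ∃ C : ℝ, 0 ≤ C ∧ ∀ n y,
        |φ n y| ≤ C * Real.exp (-b * ‖y‖ ^ 2) ∧
        ∀ i j, |partialDeriv i (partialDeriv j (φ n)) y| ≤ C * Real.exp (-b * ‖y‖ ^ 2) := by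
  let χ : ContDiffBump (0 : Plane) := ⟨1, 2, one_pos, one_lt_two⟩
  have hχ : IsTest χ := ⟨χ.contDiff, χ.hasCompactSupport⟩
  obtain ⟨A, hA0, hA⟩ : ∃ A : ℝ, 0 ≤ A ∧ ∀ y, |χ y| ≤ A ∧ (∀ i, |partialDeriv i χ y| ≤ A) ∧
      ∀ i j, |partialDeriv i (partialDeriv j χ) y| ≤ A := by
    obtain ⟨A0, h0, hA0⟩ := hχ.exists_bound
    choose A1 h1 hA1 using fun i => (hχ.partialDeriv i).exists_bound
    choose A2 h2 hA2 using fun i j => ((hχ.partialDeriv j).partialDeriv i).exists_bound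
    have s1 : 0 ≤ ∑ i, A1 i := Finset.sum_nonneg fun i _ => h1 i
    have s2 : 0 ≤ ∑ i, ∑ j, A2 i j :=
      Finset.sum_nonneg fun i _ => Finset.sum_nonneg fun j _ => h2 i j
    refine ⟨A0 + ∑ i, A1 i + ∑ i, ∑ j, A2 i j, by positivity,
      fun y => ⟨?_, fun i => ?_, fun i j => ?_⟩⟩
    · linarith [hA0 y]
    · have := Finset.single_le_sum (fun i _ => h1 i) (Finset.mem_univ i)
      linarith [hA1 i y]
    · have e1 := Finset.single_le_sum (f := fun i => ∑ j, A2 i j)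
        (fun i _ => Finset.sum_nonneg fun j _ => h2 i j) (Finset.mem_univ i)
      have e2 := Finset.single_le_sum (fun j _ => h2 i j) (Finset.mem_univ j)
      linarith [hA2 i j y]
  obtain ⟨b, hb, B, hB, hfb⟩ : ∃ b : ℝ, 0 < b ∧ ∃ B : ℝ, 0 ≤ B ∧ ∀ y,
      |f y| ≤ B * Real.exp (-b * ‖y‖ ^ 2) ∧
      (∀ i, |partialDeriv i f y| ≤ B * Real.exp (-b * ‖y‖ ^ 2)) ∧
      ∀ i j, |partialDeriv i (partialDeriv j f) y| ≤ B * Real.exp (-b * ‖y‖ ^ 2) := by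
    let F : Unit ⊕ Fin 2 ⊕ (Fin 2 × Fin 2) → Plane → ℝ :=
      Sum.elim (fun _ => f) (Sum.elim (fun i => partialDeriv i f)
        (fun p => partialDeriv p.1 (partialDeriv p.2 f)))
    obtain ⟨b, hb, B, hB, h⟩ := GaussBdd.exists_common (Finset.univ) (f := F) (by
      rintro (_ | i | ⟨i, j⟩) -
      exacts [hf.bound, hf.bound_fst i, hf.bound_snd i j])
    exact ⟨b, hb, B, hB, fun y => ⟨h (.inl ()) (Finset.mem_univ _) y,
      fun i => h (.inr (.inl i)) (Finset.mem_univ _) y,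
      fun i j => h (.inr (.inr (i, j))) (Finset.mem_univ _) y⟩⟩
  -- The approximants are `χ(y / (n + 1)) f(y)`. Since the scale is at most 1, derivatives of the
  -- cutoffs are bounded uniformly in `n`.
  let c : ℕ → ℝ := fun n => ((n : ℝ) + 1)⁻¹
  have hc0 : ∀ n, 0 < c n := fun n => by positivity
  have hc1 : ∀ n, c n ≤ 1 := fun n => inv_le_one_of_one_le₀ (by simp)
  let η : ℕ → Plane → ℝ := fun n y => χ (c n • y)
  have hη : ∀ n, ContDiff ℝ ∞ (η n) := fun n => hχ.1.comp (contDiff_const_smul (c n))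
  have d1 : ∀ n i, partialDeriv i (η n) = fun y => c n * partialDeriv i χ (c n • y) :=
    fun n i => partialDeriv_comp_smul (hχ.1.differentiable (by simp)) _ _
  have d2 : ∀ n i j, partialDeriv i (partialDeriv j (η n)) =
      fun y => c n * (c n * partialDeriv i (partialDeriv j χ) (c n • y)) := by
    intro n i j
    have hd := contDiff_partialDeriv hχ.1 j
    have hd' : Differentiable ℝ (fun y : Plane => partialDeriv j χ (c n • y)) :=
      (hd.comp (contDiff_const_smul (c n))).differentiable (by simp)
    rw [d1, partialDeriv_mul (differentiable_const _) hd',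
      partialDeriv_comp_smul (hd.differentiable (by simp))]
    ext y
    simp [partialDeriv]
  have b0 : ∀ n y, |η n y| ≤ A := fun n y => (hA _).1
  have b1 : ∀ n i y, |partialDeriv i (η n) y| ≤ A := by
    intro n i y
    rw [d1, abs_mul, abs_of_pos (hc0 n)]
    exact (mul_le_of_le_one_left (abs_nonneg _) (hc1 n)).trans ((hA _).2.1 i)
  have b2 : ∀ n i j y, |partialDeriv i (partialDeriv j (η n)) y| ≤ A := by
    intro n i j y
    rw [d2, abs_mul, abs_mul, abs_of_pos (hc0 n)]
    exact (mul_le_of_le_one_left (mul_nonneg (hc0 n).le (abs_nonneg _)) (hc1 n)).trans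
      ((mul_le_of_le_one_left (abs_nonneg _) (hc1 n)).trans ((hA _).2.2 i j))
  refine ⟨fun n y => η n y * f y, fun n => ⟨(hη n).mul hf.contDiff, ?_⟩, fun y => ?_,
    b, hb, 4 * (A * B), by positivity, fun n y => ⟨?_, fun i j => ?_⟩⟩
  · have : HasCompactSupport (η n) :=
      hχ.2.comp_homeomorph (Homeomorph.smulOfNeZero (c n) (hc0 n).ne')
    exact this.mul_right
  · have hc : Tendsto (fun n => c n * (‖y‖ + 1)) atTop (𝓝 0) := by
      simpa [c] using (tendsto_one_div_add_atTop_nhds_zero_nat (𝕜 := ℝ)).mul_const (‖y‖ + 1)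
    filter_upwards [hc.eventually (gt_mem_nhds one_pos)] with n hn
    filter_upwards [Metric.ball_mem_nhds y one_pos] with z hz
    have hz' : ‖z‖ ≤ ‖y‖ + 1 := by
      have := norm_add_le (z - y) y
      rw [sub_add_cancel] at this
      rw [Metric.mem_ball, dist_eq_norm] at hz
      linarith
    have : χ (c n • z) = 1 := χ.one_of_mem_closedBall (by
      rw [mem_closedBall_zero_iff, norm_smul, Real.norm_eq_abs, abs_of_pos (hc0 n)]
      exact (mul_le_mul_of_nonneg_left hz' (hc0 n).le).trans hn.le)
    simp [η, this]
  · have := mul_le_mul (b0 n y) (hfb y).1 (abs_nonneg _) hA0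
    rw [abs_mul]
    nlinarith [mul_nonneg (mul_nonneg hA0 hB) (Real.exp_pos (-b * ‖y‖ ^ 2)).le]
  · have df := hf.contDiff.differentiable (by simp)
    have dη := (hη n).differentiable (by simp)
    have df' := (contDiff_partialDeriv hf.contDiff j).differentiable (by simp)
    have dη' := (contDiff_partialDeriv (hη n) j).differentiable (by simp)
    rw [partialDeriv_mul dη df, partialDeriv_add (dη.fun_mul df') (dη'.fun_mul df),
      partialDeriv_mul dη df', partialDeriv_mul dη' df]
    -- The Leibniz rule yields four terms, each at most `A * B` times the Gaussian; hence the
    -- constant `4 * (A * B)`.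
    have e1 := mul_le_mul (b0 n y) ((hfb y).2.2 i j) (abs_nonneg _) hA0
    have e2 := mul_le_mul (b1 n i y) ((hfb y).2.1 j) (abs_nonneg _) hA0
    have e3 := mul_le_mul (b1 n j y) ((hfb y).2.1 i) (abs_nonneg _) hA0
    have e4 := mul_le_mul (b2 n i j y) ((hfb y).1) (abs_nonneg _) hA0
    rw [← abs_mul] at e1 e2 e3 e4
    refine (abs_add_le _ _).trans ((add_le_add (abs_add_le _ _) (abs_add_le _ _)).trans ?_)
    linarith

/-- A constant-coefficient operator of order two. -/
noncomputable def secondOrder (a : Fin 2 → Fin 2 → ℝ) (c : ℝ) (f : Plane → ℝ) (y : Plane) : ℝ :=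
  ∑ i, ∑ j, a i j * partialDeriv i (partialDeriv j f) y + c * f y

lemma continuous_secondOrder (a : Fin 2 → Fin 2 → ℝ) (c : ℝ) {f : Plane → ℝ}
    (hf : ContDiff ℝ ∞ f) : Continuous (secondOrder a c f) := by
  have h i j : Continuous (partialDeriv i (partialDeriv j f)) :=
    (contDiff_partialDeriv (contDiff_partialDeriv hf j) i).continuous
  have h0 := hf.continuous
  unfold secondOrder
  fun_prop

/-- A weak identity for test functions extends to Gaussian-dominated functions. -/
lemma SmoothGauss.integral_secondOrder {f h g : Plane → ℝ} (hf : SmoothGauss f) (hh : Tame h)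
    (hg : Tame g) (a : Fin 2 → Fin 2 → ℝ) (c : ℝ)
    (heq : ∀ φ, IsTest φ → ∫ y, secondOrder a c φ y * h y = ∫ y, φ y * g y) :
    ∫ y, secondOrder a c f y * h y = ∫ y, f y * g y := by
  obtain ⟨φ, hφ, hev, b, hb, C, hC, hle⟩ := hf.exists_approx
  -- Dominated convergence, used for both sides of the identity; at each point the sequence is
  -- eventually constant.
  have lim : ∀ (F : ℕ → Plane → ℝ) (G k : Plane → ℝ) (M : ℝ), 0 ≤ M → Tame k →
      (∀ n, Continuous (F n)) → (∀ y, ∀ᶠ n in atTop, F n y = G y) →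
      (∀ n y, |F n y| ≤ M * Real.exp (-b * ‖y‖ ^ 2)) →
      Tendsto (fun n => ∫ y, F n y * k y) atTop (𝓝 (∫ y, G y * k y)) := by
    intro F G k M hM hk hF hFG hFM
    refine tendsto_integral_of_dominated_convergence
      (fun y => M * ‖Real.exp (-b * ‖y‖ ^ 2) * k y‖)
      (fun n => (hF n).aestronglyMeasurable.mul hk.aestronglyMeasurable)
      ((hk b hb).norm.const_mul M) (fun n => ae_of_all _ fun y => ?_) (ae_of_all _ fun y => ?_)
    · rw [norm_mul, norm_mul, ← mul_assoc, Real.norm_eq_abs (Real.exp _), Real.abs_exp]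
      exact mul_le_mul_of_nonneg_right (hFM n y) (norm_nonneg _)
    · refine tendsto_const_nhds.congr' ?_
      filter_upwards [hFG y] with n hn
      rw [hn]
  have l1 := lim (fun n => secondOrder a c (φ n)) (secondOrder a c f) h
    ((∑ i, ∑ j, |a i j| + |c|) * C) (by positivity) hh
    (fun n => continuous_secondOrder a c (hφ n).1) (fun y => by
      filter_upwards [hev y] with n hn
      have h2 i j := (partialDeriv_congr (partialDeriv_congr hn j) i).eq_of_nhds
      simp only [secondOrder, h2, hn.eq_of_nhds]) (fun n y => by
      rw [secondOrder, mul_assoc, add_mul, Finset.sum_mul]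
      refine (abs_add_le _ _).trans (add_le_add ((Finset.abs_sum_le_sum_abs _ _).trans
        (Finset.sum_le_sum fun i _ => ?_)) ?_)
      · rw [Finset.sum_mul]
        refine (Finset.abs_sum_le_sum_abs _ _).trans (Finset.sum_le_sum fun j _ => ?_)
        rw [abs_mul]
        exact mul_le_mul_of_nonneg_left ((hle n y).2 i j) (abs_nonneg _)
      · rw [abs_mul]
        exact mul_le_mul_of_nonneg_left (hle n y).1 (abs_nonneg _))
  have l2 := lim φ f g C hC hg (fun n => (hφ n).1.continuous)
    (fun y => (hev y).mono fun n hn => hn.eq_of_nhds) (fun n y => (hle n y).1)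
  refine tendsto_nhds_unique l1 (l2.congr fun n => ?_)
  exact (heq _ (hφ n)).symm

lemma laplacian_eq {φ : Plane → ℝ} (hφ : ContDiff ℝ ∞ φ) (y : Plane) :
    Laplacian.laplacian φ y =
      partialDeriv 0 (partialDeriv 0 φ) y + partialDeriv 1 (partialDeriv 1 φ) y := by
  rw [InnerProductSpace.laplacian_eq_iteratedFDeriv_orthonormalBasis φ
    (EuclideanSpace.basisFun (Fin 2) ℝ)]
  have h (i : Fin 2) : partialDeriv i (partialDeriv i φ) y =
      iteratedFDeriv ℝ 2 φ y ![EuclideanSpace.single i 1, EuclideanSpace.single i 1] := by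
    have hd : DifferentiableAt ℝ (fderiv ℝ φ) y :=
      ((hφ.fderiv_right (m := ∞) (by simp)).differentiable (by simp)) y
    rw [iteratedFDeriv_two_apply]
    unfold partialDeriv
    rw [fderiv_clm_apply hd (differentiableAt_const _)]
    simp
  simp [h, Fin.sum_univ_two]

/-! ### The heat flow and Duhamel's formula. -/

/-- The correlation of `h` with the kernel `K`. -/
noncomputable def corr (K h : Plane → ℝ) (x : Plane) : ℝ := ∫ y, K (y - x) * h y

lemma integrable_corr {K h : Plane → ℝ} (hK : GaussBdd K) (hc : Continuous K) (hh : Tame h)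
    (x : Plane) : Integrable (fun y => K (y - x) * h y) :=
  hh.integrable_mul (hK.comp_sub x) (hc.comp (continuous_id.sub continuous_const))

/-- Differentiation under the integral sign, using the heat equation for the kernel. -/
lemma hasDerivAt_corr_heat {h : Plane → ℝ} (hh : Tame h) (x : Plane) {t : ℝ} (ht : 0 < t) :
    HasDerivAt (fun s => corr (heat s) h x)
      (corr (fun z => heatSnd 0 0 t z + heatSnd 1 1 t z) h x) t := by
  have hcont (s : ℝ) : Continuous (fun y : Plane => heat s (y - x)) :=
    (contDiff_heat s).continuous.comp (continuous_id.sub continuous_const)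
  have hcont' : Continuous (fun y : Plane => heatSnd 0 0 t (y - x) + heatSnd 1 1 t (y - x)) :=
    ((contDiff_heatSnd 0 0 t).continuous.comp (continuous_id.sub continuous_const)).add
      ((contDiff_heatSnd 1 1 t).continuous.comp (continuous_id.sub continuous_const))
  -- For `s` in `(t/2, 2t)`, the prefactors of the envelope are largest at `t/2` and its Gaussian is
  -- widest at `2t`; their combination dominates uniformly in `s`.
  let C : ℝ := 4 * (t / 2)⁻¹ * (4 * Real.pi * (t / 2))⁻¹
  let g : Plane → ℝ := fun z => C * Real.exp (-(16 * t)⁻¹ * ‖z‖ ^ 2)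
  have hC : 0 ≤ C := by positivity
  have hg : GaussBdd g := ⟨(16 * t)⁻¹, by positivity, C, hC, fun z => by
    rw [abs_of_nonneg (mul_nonneg hC (Real.exp_pos _).le)]⟩
  have hgc : Continuous g := by fun_prop
  refine (hasDerivAt_integral_of_dominated_loc_of_deriv_le (s := Set.Ioo (t / 2) (2 * t))
    (bound := fun y => ‖g (y - x) * h y‖)
    (F := fun s y => heat s (y - x) * h y)
    (F' := fun s y => (heatSnd 0 0 s (y - x) + heatSnd 1 1 s (y - x)) * h y)
    (Ioo_mem_nhds (by linarith) (by linarith))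
    (Eventually.of_forall fun s => (hcont s).aestronglyMeasurable.mul hh.aestronglyMeasurable)
    (integrable_corr (gaussBdd_heat ht) (contDiff_heat t).continuous hh x)
    (hcont'.aestronglyMeasurable.mul hh.aestronglyMeasurable)
    (ae_of_all _ fun y s hs => ?_) (integrable_corr hg hgc hh x).norm
    (ae_of_all _ fun y s hs => ?_)).2
  · have hs0 : 0 < s := by have := hs.1; linarith
    rw [norm_mul, norm_mul]
    refine mul_le_mul_of_nonneg_right ?_ (norm_nonneg _)
    rw [Real.norm_eq_abs, Real.norm_eq_abs, abs_of_nonneg (a := g _)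
      (mul_nonneg hC (Real.exp_pos _).le)]
    refine (abs_add_le _ _).trans ((add_le_add (abs_heatSnd_le 0 0 hs0 _)
      (abs_heatSnd_le 1 1 hs0 _)).trans ?_)
    have h1 : s⁻¹ ≤ (t / 2)⁻¹ := inv_anti₀ (by positivity) hs.1.le
    have h2 : (4 * Real.pi * s)⁻¹ ≤ (4 * Real.pi * (t / 2))⁻¹ :=
      inv_anti₀ (by positivity) (mul_le_mul_of_nonneg_left hs.1.le (by positivity))
    have h3 : (16 * t)⁻¹ ≤ (8 * s)⁻¹ := inv_anti₀ (by positivity) (by linarith [hs.2])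
    have h4 : Real.exp (-(8 * s)⁻¹ * ‖y - x‖ ^ 2) ≤ Real.exp (-(16 * t)⁻¹ * ‖y - x‖ ^ 2) := by
      rw [Real.exp_le_exp]; gcongr
    calc 2 * s⁻¹ * envelope s (y - x) + 2 * s⁻¹ * envelope s (y - x)
        = 4 * s⁻¹ * (4 * Real.pi * s)⁻¹ * Real.exp (-(8 * s)⁻¹ * ‖y - x‖ ^ 2) := by
          unfold envelope; ring
      _ ≤ g (y - x) := by
          simp only [g, C]
          gcongr
  · have hs0 : 0 < s := by have := hs.1; linarith
    exact (hasDerivAt_heat hs0 (y - x)).mul_const (h y)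

/-- The coefficients of the operator `Δ`. -/
def laplaceCoeff (i j : Fin 2) : ℝ := if i = j then 1 else 0

lemma secondOrder_laplaceCoeff (c : ℝ) (f : Plane → ℝ) (y : Plane) :
    secondOrder laplaceCoeff c f y =
      partialDeriv 0 (partialDeriv 0 f) y + partialDeriv 1 (partialDeriv 1 f) y + c * f y := by
  simp [secondOrder, laplaceCoeff, Fin.sum_univ_two]

lemma integrableOn_exp_neg_mul_inv_sqrt :
    IntegrableOn (fun t : ℝ => Real.exp (-t) * (√t)⁻¹) (Set.Ioi 0) := by
  refine (Real.GammaIntegral_convergent (s := 1 / 2) (by norm_num)).congr_fun (fun t ht => ?_)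
    measurableSet_Ioi
  have ht' : (0 : ℝ) < t := ht
  simp only [Real.sqrt_eq_rpow]
  rw [← Real.rpow_neg ht'.le]
  norm_num

/-- Duhamel's formula for the screened Poisson equation at positive times. -/
lemma exp_neg_mul_corr_heat_eq {ψ f : Plane → ℝ} (hψ : Tame ψ) (hf : Tame f)
    (heq : ∀ φ, IsTest φ → ∫ y, secondOrder laplaceCoeff (-1) φ y * ψ y = ∫ y, φ y * f y)
    {x : Plane} {B : ℝ} (hB : ∀ t, 0 < t → |corr (heat t) f x| ≤ B * (√t)⁻¹)
    (hdecay : Tendsto (fun t => Real.exp (-t) * corr (heat t) ψ x) atTop (𝓝 0))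
    {s : ℝ} (hs : 0 < s) :
    Real.exp (-s) * corr (heat s) ψ x =
      -∫ t in Set.Ioi s, Real.exp (-t) * corr (heat t) f x := by
  have hder : ∀ t ∈ Set.Ici s, HasDerivAt (fun t => Real.exp (-t) * corr (heat t) ψ x)
      (Real.exp (-t) * corr (heat t) f x) t := by
    intro t ht
    have ht0 : 0 < t := lt_of_lt_of_le hs ht
    have he : HasDerivAt (fun t : ℝ => Real.exp (-t)) (-Real.exp (-t)) t := by
      simpa using (hasDerivAt_neg t).exp
    refine (he.mul (hasDerivAt_corr_heat hψ x ht0)).congr_deriv ?_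
    -- The weak equation is tested with the heat kernel centred at `x`.
    have h1 := (smoothGauss_heat ht0 x).integral_secondOrder hψ hf laplaceCoeff (-1) heq
    have h2 : corr (heat t) f x = corr (fun z => heatSnd 0 0 t z + heatSnd 1 1 t z) ψ x -
        corr (heat t) ψ x := by
      unfold corr
      rw [← h1, ← integral_sub]
      · refine integral_congr_ae (ae_of_all _ fun y => ?_)
        simp only [secondOrder_laplaceCoeff, partialDeriv_comp_sub, partialDeriv_heat,
          partialDeriv_heatFst]
        ring
      · simp only [add_mul]
        exact (integrable_corr (gaussBdd_heatSnd 0 0 ht0) (contDiff_heatSnd 0 0 t).continuous hψ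
          x).add (integrable_corr (gaussBdd_heatSnd 1 1 ht0) (contDiff_heatSnd 1 1 t).continuous
            hψ x)
      · exact integrable_corr (gaussBdd_heat ht0) (contDiff_heat t).continuous hψ x
    rw [h2]
    ring
  have hint : IntegrableOn (fun t => Real.exp (-t) * corr (heat t) f x) (Set.Ioi s) := by
    have hc : ContinuousOn (fun t => Real.exp (-t) * corr (heat t) f x) (Set.Ioi s) := by
      intro t ht
      have h1 := (hasDerivAt_corr_heat hf x (lt_trans hs ht)).continuousAt
      exact ((by fun_prop : Continuous fun t : ℝ => Real.exp (-t)).continuousAt.mul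
        h1).continuousWithinAt
    refine Integrable.mono' ((integrableOn_exp_neg_mul_inv_sqrt.mono_set
      (Set.Ioi_subset_Ioi hs.le)).const_mul B) (hc.aestronglyMeasurable measurableSet_Ioi) ?_
    filter_upwards [ae_restrict_mem measurableSet_Ioi] with t ht
    rw [norm_mul, Real.norm_eq_abs, Real.abs_exp, mul_left_comm]
    exact mul_le_mul_of_nonneg_left (hB t (lt_trans hs ht)) (Real.exp_pos _).le
  rw [integral_Ioi_of_hasDerivAt_of_tendsto' hder hint hdecay]
  ring

/-! ### Pairing the heat flow with test functions, and its limit at time zero. -/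

lemma IsTest.exists_support {φ : Plane → ℝ} (hφ : IsTest φ) :
    ∃ R : ℝ, ∀ x, φ x ≠ 0 → ‖x‖ ≤ R := by
  obtain ⟨R, hR⟩ := hφ.2.isCompact.isBounded.exists_norm_le
  exact ⟨R, fun x hx => hR x (subset_tsupport _ hx)⟩

lemma IsTest.integrable {φ : Plane → ℝ} (hφ : IsTest φ) : Integrable φ :=
  hφ.1.continuous.integrable_of_hasCompactSupport hφ.2

/-- The support of `φ` confines the centre to a ball, so recentring the Gaussian costs a fixed
constant. This justifies Fubini below. -/
lemma integrable_corr_prod {K h φ : Plane → ℝ} (hK : GaussBdd K) (hc : Continuous K)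
    (hh : Tame h) (hφ : IsTest φ) :
    Integrable (fun p : Plane × Plane => K (p.2 - p.1) * h p.2 * φ p.1)
      (volume.prod volume) := by
  obtain ⟨b, hb, C, hC, hle⟩ := hK
  obtain ⟨R, hR⟩ := hφ.exists_support
  have hR0 : 0 ≤ |R| := abs_nonneg R
  refine ((hφ.integrable.norm).mul_prod
    (((hh (b / 2) (by positivity)).norm).const_mul (C * Real.exp (b * |R| ^ 2)))).mono' ?_
    (ae_of_all _ fun p => ?_)
  · refine AEStronglyMeasurable.mul (AEStronglyMeasurable.mul ?_ ?_) ?_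
    · exact (hc.comp (continuous_snd.sub continuous_fst)).aestronglyMeasurable
    · exact hh.aestronglyMeasurable.comp_snd
    · exact hφ.integrable.aestronglyMeasurable.comp_fst
  · by_cases hp : φ p.1 = 0
    · simp [hp]
    have h1 := (hle (p.2 - p.1)).trans (mul_le_mul_of_nonneg_left (exp_sub_le hb p.1 p.2) hC)
    have h2 : Real.exp (b * ‖p.1‖ ^ 2) ≤ Real.exp (b * |R| ^ 2) := by
      rw [Real.exp_le_exp]
      have := (hR p.1 hp).trans (le_abs_self R)
      gcongr
    rw [norm_mul, norm_mul, norm_mul, Real.norm_eq_abs (Real.exp _), Real.abs_exp,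
      Real.norm_eq_abs (K _)]
    have h3 : |K (p.2 - p.1)| ≤
        C * Real.exp (b * |R| ^ 2) * Real.exp (-(b / 2) * ‖p.2‖ ^ 2) := by
      refine h1.trans ?_
      rw [mul_assoc]
      gcongr
    calc |K (p.2 - p.1)| * ‖h p.2‖ * ‖φ p.1‖
        ≤ C * Real.exp (b * |R| ^ 2) * Real.exp (-(b / 2) * ‖p.2‖ ^ 2) * ‖h p.2‖ * ‖φ p.1‖ := by
          gcongr
      _ = _ := by ring

lemma integral_corr_mul {K h φ : Plane → ℝ} (hK : GaussBdd K) (hc : Continuous K)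
    (hh : Tame h) (hφ : IsTest φ) :
    ∫ x, corr K h x * φ x = ∫ y, (∫ x, K (y - x) * φ x) * h y := by
  have h1 := integral_integral_swap (f := fun x y => K (y - x) * h y * φ x)
    (integrable_corr_prod hK hc hh hφ)
  calc ∫ x, corr K h x * φ x = ∫ x, ∫ y, K (y - x) * h y * φ x := by
        simp only [corr, integral_mul_const]
    _ = _ := h1
    _ = _ := by
        refine integral_congr_ae (ae_of_all _ fun y => ?_)
        simp only [← integral_mul_const]
        refine integral_congr_ae (ae_of_all _ fun x => ?_)
        simp only []
        ring

lemma partialDeriv_comp_sub_left {K : Plane → ℝ} (hK : Differentiable ℝ K) (y : Plane)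
    (i : Fin 2) :
    partialDeriv i (fun x => K (y - x)) = fun x => -partialDeriv i K (y - x) := by
  ext x
  have h : HasFDerivAt (fun x : Plane => K (y - x))
      ((fderiv ℝ K (y - x)).comp (-ContinuousLinearMap.id ℝ Plane)) x :=
    (hK (y - x)).hasFDerivAt.comp x ((hasFDerivAt_id x).const_sub y)
  simp [partialDeriv, h.fderiv]

/-- Partial derivatives can be moved from the test function onto the kernel. -/
lemma integral_corr_mul_partialDeriv {K h φ : Plane → ℝ} (hK : GaussBdd K)
    (hc : ContDiff ℝ ∞ K) (i : Fin 2) (hK' : GaussBdd (partialDeriv i K))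
    (hh : Tame h) (hφ : IsTest φ) :
    ∫ x, corr K h x * partialDeriv i φ x = ∫ x, corr (partialDeriv i K) h x * φ x := by
  rw [integral_corr_mul hK hc.continuous hh (hφ.partialDeriv i),
    integral_corr_mul hK' (contDiff_partialDeriv hc i).continuous hh hφ]
  refine integral_congr_ae (ae_of_all _ fun y => ?_)
  simp only []
  congr 1
  have hcK : ContDiff ℝ ∞ (fun x => K (y - x)) := hc.comp (contDiff_const.sub contDiff_id)
  have hcK' := contDiff_partialDeriv hcK i
  -- The minus sign from integrating by parts cancels the one from differentiating `x ↦ K (y - x)`.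
  have key := integral_mul_fderiv_eq_neg_fderiv_mul_of_integrable (μ := (volume : Measure Plane))
    (f := fun x => K (y - x)) (g := φ)
    (v := (EuclideanSpace.single i 1 : Plane))
    ((hcK'.continuous.mul hφ.1.continuous).integrable_of_hasCompactSupport hφ.2.mul_left)
    ((hcK.continuous.mul (hφ.partialDeriv i).1.continuous).integrable_of_hasCompactSupport
      (hφ.partialDeriv i).2.mul_left)
    ((hcK.continuous.mul hφ.1.continuous).integrable_of_hasCompactSupport hφ.2.mul_left)
    (fun x _ => hcK.differentiable (by simp) x) (fun x _ => hφ.1.differentiable (by simp) x)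
  refine key.trans ?_
  rw [← integral_neg]
  refine integral_congr_ae (ae_of_all _ fun x => ?_)
  have := congrFun (partialDeriv_comp_sub_left (hc.differentiable (by simp)) y i) x
  simp only [partialDeriv] at this ⊢
  rw [this]
  ring

lemma tendsto_integral_heat_mul {χ : Plane → ℝ} (hχ : Integrable χ) (hc : Continuous χ)
    (y : Plane) :
    Tendsto (fun s => ∫ x, heat s (y - x) * χ x) (𝓝[>] 0) (𝓝 (χ y)) := by
  have h1 := Real.tendsto_integral_gaussian_smul' (f := fun x => (χ x : ℂ)) hχ.ofReal
    (v := y) (Complex.continuous_ofReal.comp hc).continuousAt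
  -- The Gaussian approximate identity has parameter `c → ∞` and exponent `-π² c ‖·‖²`; matching it
  -- with the heat kernel forces `c = 1 / (4π² s)`.
  have h2 : Tendsto (fun s : ℝ => (4 * Real.pi ^ 2 * s)⁻¹) (𝓝[>] 0) atTop := by
    refine (tendsto_inv_nhdsGT_zero (𝕜 := ℝ)).comp ?_
    refine tendsto_nhdsWithin_iff.2 ⟨?_, ?_⟩
    · refine Tendsto.mono_left ?_ nhdsWithin_le_nhds
      have : Continuous fun s : ℝ => 4 * Real.pi ^ 2 * s := by fun_prop
      simpa using this.tendsto 0
    · filter_upwards [self_mem_nhdsWithin] with s hs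
      have hs' : (0 : ℝ) < s := hs
      exact mul_pos (by positivity) hs'
  have h3 := h1.comp h2
  have h4 : Tendsto (fun s => ((∫ x, heat s (y - x) * χ x : ℝ) : ℂ)) (𝓝[>] 0)
      (𝓝 ((χ y : ℝ) : ℂ)) := by
    refine h3.congr' ?_
    filter_upwards [self_mem_nhdsWithin] with s hs
    have hs' : (0 : ℝ) < s := hs
    have hπ := Real.pi_pos
    simp only [Function.comp_def]
    rw [← integral_complex_ofReal]
    refine integral_congr_ae (ae_of_all _ fun x => ?_)
    simp only [heat, smul_eq_mul, finrank_euclideanSpace, Fintype.card_fin]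
    have e1 : ((2 : ℕ) : ℂ) / 2 = 1 := by norm_num
    rw [e1, Complex.cpow_one]
    push_cast
    congr 2
    · have : (Real.pi : ℂ) ≠ 0 := by exact_mod_cast hπ.ne'
      have : (s : ℂ) ≠ 0 := by exact_mod_cast hs'.ne'
      field_simp
    · congr 1
      have : (Real.pi : ℂ) ≠ 0 := by exact_mod_cast hπ.ne'
      have : (s : ℂ) ≠ 0 := by exact_mod_cast hs'.ne'
      field_simp
  have h5 := (Complex.continuous_re.tendsto _).comp h4
  simpa [Function.comp_def] using h5

/-- Domination uniform in small times: half of the exponent keeps an envelope of mass 2, and the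
other half, at least as strong as at `s = 1`, decays in `y` because `x` stays in the support of `χ`.
-/
lemma IsTest.exists_heat_bound {χ : Plane → ℝ} (hχ : IsTest χ) :
    ∃ C : ℝ, ∀ s, 0 < s → s ≤ 1 → ∀ y,
      |∫ x, heat s (y - x) * χ x| ≤ C * Real.exp (-16⁻¹ * ‖y‖ ^ 2) := by
  obtain ⟨M, hM, hχM⟩ := hχ.exists_bound
  obtain ⟨R, hR⟩ := hχ.exists_support
  refine ⟨M * Real.exp (8⁻¹ * |R| ^ 2) * 2, fun s hs hs1 y => ?_⟩
  have hle : ∀ x, ‖heat s (y - x) * χ x‖ ≤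
      M * Real.exp (8⁻¹ * |R| ^ 2) * Real.exp (-16⁻¹ * ‖y‖ ^ 2) * envelope s (y - x) := by
    intro x
    have he := envelope_nonneg hs (y - x)
    by_cases hx : χ x = 0
    · rw [hx, mul_zero, norm_zero]; positivity
    rw [heat_eq_envelope hs, norm_mul, norm_mul, Real.norm_eq_abs, Real.norm_eq_abs,
      Real.abs_exp, abs_of_nonneg he]
    have h1 : Real.exp (-((8 * s)⁻¹ * ‖y - x‖ ^ 2)) ≤ Real.exp (-8⁻¹ * ‖y - x‖ ^ 2) := by
      rw [Real.exp_le_exp, ← neg_mul]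
      have : (8 : ℝ)⁻¹ ≤ (8 * s)⁻¹ := inv_anti₀ (by positivity) (by linarith)
      gcongr
    have h2 := exp_sub_le (b := 8⁻¹) (by norm_num) x y
    have h3 : Real.exp (8⁻¹ * ‖x‖ ^ 2) ≤ Real.exp (8⁻¹ * |R| ^ 2) := by
      rw [Real.exp_le_exp]
      have := (hR x hx).trans (le_abs_self R)
      gcongr
    rw [show (8 : ℝ)⁻¹ / 2 = 16⁻¹ by norm_num] at h2
    have h4 := (h1.trans h2).trans (mul_le_mul_of_nonneg_right h3 (Real.exp_pos _).le)
    calc envelope s (y - x) * Real.exp (-((8 * s)⁻¹ * ‖y - x‖ ^ 2)) * ‖χ x‖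
        ≤ envelope s (y - x) * (Real.exp (8⁻¹ * |R| ^ 2) * Real.exp (-16⁻¹ * ‖y‖ ^ 2)) * M := by
          gcongr
          exact hχM x
      _ = _ := by ring
  have hint : Integrable (fun x => envelope s (y - x)) := (integrable_envelope hs).comp_sub_left y
  have h := norm_integral_le_of_norm_le (hint.const_mul
    (M * Real.exp (8⁻¹ * |R| ^ 2) * Real.exp (-16⁻¹ * ‖y‖ ^ 2))) (ae_of_all _ hle)
  rw [integral_const_mul, integral_sub_left_eq_self (envelope s), integral_envelope hs] at h
  rw [← Real.norm_eq_abs]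
  linarith

/-- The heat flow of `h` converges to `h` in the sense of distributions. -/
lemma tendsto_integral_corr_heat {h χ : Plane → ℝ} (hh : Tame h) (hχ : IsTest χ) :
    Tendsto (fun s => ∫ x, corr (heat s) h x * χ x) (𝓝[>] 0) (𝓝 (∫ y, χ y * h y)) := by
  obtain ⟨C, hC⟩ := hχ.exists_heat_bound
  have hev : ∀ᶠ s : ℝ in 𝓝[>] 0, 0 < s ∧ s ≤ 1 := by
    filter_upwards [Ioc_mem_nhdsGT one_pos] with s hs
    exact hs
  have h1 : Tendsto (fun s => ∫ y, (∫ x, heat s (y - x) * χ x) * h y) (𝓝[>] 0)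
      (𝓝 (∫ y, χ y * h y)) := by
    refine tendsto_integral_filter_of_dominated_convergence
      (fun y => |C| * ‖Real.exp (-16⁻¹ * ‖y‖ ^ 2) * h y‖) ?_ ?_
      ((hh 16⁻¹ (by norm_num)).norm.const_mul _) (ae_of_all _ fun y => ?_)
    · refine Eventually.of_forall fun s => AEStronglyMeasurable.mul ?_ hh.aestronglyMeasurable
      have hc : Continuous (fun p : Plane × Plane => heat s (p.1 - p.2) * χ p.2) :=
        ((contDiff_heat s).continuous.comp (continuous_fst.sub continuous_snd)).mul
          (hχ.1.continuous.comp continuous_snd)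
      exact (hc.stronglyMeasurable.integral_prod_right (ν := volume)).aestronglyMeasurable
    · filter_upwards [hev] with s hs
      refine ae_of_all _ fun y => ?_
      rw [norm_mul, norm_mul, Real.norm_eq_abs (Real.exp _), Real.abs_exp, ← mul_assoc]
      refine mul_le_mul_of_nonneg_right ((hC s hs.1 hs.2 y).trans ?_) (norm_nonneg _)
      exact mul_le_mul_of_nonneg_right (le_abs_self C) (Real.exp_pos _).le
    · exact (tendsto_integral_heat_mul hχ.integrable hχ.1.continuous y).mul_const _
  refine h1.congr' ?_
  filter_upwards [hev] with s hs
  exact (integral_corr_mul (gaussBdd_heat hs.1) (contDiff_heat s).continuous hh hχ).symm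

/-! ### Time integrals and the representation of weak solutions. -/

lemma measurable_heat : Measurable (fun p : ℝ × Plane => heat p.1 p.2) := by
  unfold heat
  fun_prop

lemma measurable_heatFst (i : Fin 2) : Measurable (fun p : ℝ × Plane => heatFst i p.1 p.2) := by
  have := measurable_heat
  unfold heatFst
  fun_prop

lemma measurable_heatSnd (i j : Fin 2) :
    Measurable (fun p : ℝ × Plane => heatSnd i j p.1 p.2) := by
  have := measurable_heat
  unfold heatSnd
  split_ifs <;> fun_prop

lemma measurable_corr {K : ℝ → Plane → ℝ} (hK : Measurable (fun p : ℝ × Plane => K p.1 p.2))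
    {h : Plane → ℝ} (hh : AEStronglyMeasurable h volume) :
    Measurable (fun p : ℝ × Plane => corr (K p.1) h p.2) := by
  obtain ⟨g, hg, hhg⟩ := hh
  have : (fun p : ℝ × Plane => corr (K p.1) h p.2) =
      fun p => ∫ y, K p.1 (y - p.2) * g y := by
    ext p
    refine integral_congr_ae ?_
    filter_upwards [hhg] with y hy
    rw [hy]
  rw [this]
  have hm : Measurable (fun q : (ℝ × Plane) × Plane => K q.1.1 (q.2 - q.1.2) * g q.2) :=
    (hK.comp (measurable_fst.fst.prodMk (measurable_snd.sub measurable_fst.snd))).mul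
      (hg.measurable.comp measurable_snd)
  exact (hm.stronglyMeasurable.integral_prod_right (ν := volume)).measurable

/-- The Laplace transform at `1` of a family of functions. -/
noncomputable def timeIntegral (H : ℝ → Plane → ℝ) (x : Plane) : ℝ :=
  ∫ t in Set.Ioi (0 : ℝ), Real.exp (-t) * H t x

lemma measurable_timeIntegral {H : ℝ → Plane → ℝ}
    (hH : Measurable (fun p : ℝ × Plane => H p.1 p.2)) : Measurable (timeIntegral H) := by
  have hm : Measurable (fun q : Plane × ℝ => Real.exp (-q.2) * H q.2 q.1) :=
    (by fun_prop : Measurable fun q : Plane × ℝ => Real.exp (-q.2)).mul (hH.comp measurable_swap)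
  exact (hm.stronglyMeasurable.integral_prod_right
    (ν := volume.restrict (Set.Ioi (0 : ℝ)))).measurable

lemma integral_timeIntegral_mul {H : ℝ → Plane → ℝ}
    (hH : Measurable (fun p : ℝ × Plane => H p.1 p.2)) {B : ℝ}
    (hB : ∀ t, 0 < t → ∀ x, |H t x| ≤ B * (√t)⁻¹) {φ : Plane → ℝ} (hφ : Integrable φ) :
    ∫ x, timeIntegral H x * φ x =
      ∫ t in Set.Ioi (0 : ℝ), Real.exp (-t) * ∫ x, H t x * φ x := by
  have hint : Integrable (Function.uncurry fun x t => Real.exp (-t) * H t x * φ x)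
      ((volume : Measure Plane).prod (volume.restrict (Set.Ioi (0 : ℝ)))) := by
    have hdom := hφ.norm.mul_prod (integrableOn_exp_neg_mul_inv_sqrt.const_mul B)
    refine hdom.mono' ?_ ?_
    · have hm : Measurable (fun q : Plane × ℝ => Real.exp (-q.2) * H q.2 q.1) :=
        (by fun_prop : Measurable fun q : Plane × ℝ => Real.exp (-q.2)).mul
          (hH.comp measurable_swap)
      exact hm.aestronglyMeasurable.mul hφ.aestronglyMeasurable.comp_fst
    · have hpos : ∀ᵐ q : Plane × ℝ ∂((volume : Measure Plane).prod
          (volume.restrict (Set.Ioi (0 : ℝ)))), 0 < q.2 :=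
        Measure.quasiMeasurePreserving_snd.ae (ae_restrict_mem measurableSet_Ioi)
      filter_upwards [hpos] with q hq
      simp only [Function.uncurry, norm_mul, Real.norm_eq_abs, Real.abs_exp]
      calc Real.exp (-q.2) * |H q.2 q.1| * |φ q.1|
          ≤ Real.exp (-q.2) * (B * (√q.2)⁻¹) * |φ q.1| := by
            gcongr
            exact hB q.2 hq q.1
        _ = _ := by ring
  have := integral_integral_swap hint
  simp only [integral_mul_const] at this
  refine this.trans ?_
  simp only [mul_assoc, integral_const_mul]

lemma integrableOn_time {H : ℝ → Plane → ℝ}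
    (hH : Measurable (fun p : ℝ × Plane => H p.1 p.2)) {B : ℝ} {x : Plane}
    (hB : ∀ t, 0 < t → |H t x| ≤ B * (√t)⁻¹) :
    IntegrableOn (fun t => Real.exp (-t) * H t x) (Set.Ioi 0) := by
  refine (integrableOn_exp_neg_mul_inv_sqrt.const_mul B).mono' ?_ ?_
  · exact ((by fun_prop : Measurable fun t : ℝ => Real.exp (-t)).mul
      (hH.comp (measurable_id.prodMk measurable_const))).aestronglyMeasurable
  · filter_upwards [ae_restrict_mem measurableSet_Ioi] with t ht
    rw [norm_mul, Real.norm_eq_abs, Real.abs_exp, mul_left_comm]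
    exact mul_le_mul_of_nonneg_left (hB t ht) (Real.exp_pos _).le

lemma integral_exp_neg_mul_inv_sqrt :
    ∫ t in Set.Ioi (0 : ℝ), Real.exp (-t) * (√t)⁻¹ = √Real.pi := by
  rw [← Real.Gamma_one_half_eq, Real.Gamma_eq_integral (by norm_num)]
  refine setIntegral_congr_fun measurableSet_Ioi (fun t ht => ?_)
  have ht' : (0 : ℝ) < t := ht
  simp only [Real.sqrt_eq_rpow]
  rw [← Real.rpow_neg ht'.le]
  norm_num

lemma abs_setIntegral_time_le {H : ℝ → Plane → ℝ} {B : ℝ} {x : Plane} (hB0 : 0 ≤ B)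
    (hB : ∀ t, 0 < t → |H t x| ≤ B * (√t)⁻¹) {s : ℝ} (hs : 0 ≤ s) :
    |∫ t in Set.Ioi s, Real.exp (-t) * H t x| ≤ B * √Real.pi := by
  have h1 : ∀ᵐ t ∂(volume.restrict (Set.Ioi s)),
      ‖Real.exp (-t) * H t x‖ ≤ B * (Real.exp (-t) * (√t)⁻¹) := by
    filter_upwards [ae_restrict_mem measurableSet_Ioi] with t ht
    rw [norm_mul, Real.norm_eq_abs, Real.abs_exp, mul_left_comm]
    exact mul_le_mul_of_nonneg_left (hB t (lt_of_le_of_lt hs ht)) (Real.exp_pos _).le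
  have hi : IntegrableOn (fun t => B * (Real.exp (-t) * (√t)⁻¹)) (Set.Ioi 0) :=
    integrableOn_exp_neg_mul_inv_sqrt.const_mul B
  have h2 := norm_integral_le_of_norm_le (hi.mono_set (Set.Ioi_subset_Ioi hs)) h1
  rw [← Real.norm_eq_abs, ← integral_exp_neg_mul_inv_sqrt, ← integral_const_mul]
  refine h2.trans (setIntegral_mono_set hi ?_ (Set.Ioi_subset_Ioi hs).eventuallyLE)
  filter_upwards with t
  positivity

/-- A decaying weak solution is minus the time integral of the heat flow of its source. -/
lemma integral_mul_eq_neg_timeIntegral {ψ f : Plane → ℝ} (hψ : Tame ψ) (hf : Tame f)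
    (heq : ∀ φ, IsTest φ → ∫ y, secondOrder laplaceCoeff (-1) φ y * ψ y = ∫ y, φ y * f y)
    {B : ℝ} (hB0 : 0 ≤ B) (hB : ∀ t, 0 < t → ∀ x, |corr (heat t) f x| ≤ B * (√t)⁻¹)
    (hdecay : ∀ x, Tendsto (fun t => Real.exp (-t) * corr (heat t) ψ x) atTop (𝓝 0))
    {χ : Plane → ℝ} (hχ : IsTest χ) :
    ∫ y, χ y * ψ y = -∫ x, timeIntegral (fun t => corr (heat t) f) x * χ x := by
  have hm := measurable_corr measurable_heat hf.aestronglyMeasurable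
  have hrep : ∀ s, 0 < s → ∀ x, ∫ t in Set.Ioi s, Real.exp (-t) * corr (heat t) f x =
      -(Real.exp (-s) * corr (heat s) ψ x) := fun s hs x => by
    rw [exp_neg_mul_corr_heat_eq hψ hf heq (fun t ht => hB t ht x) (hdecay x) hs, neg_neg]
  have hpos : ∀ᶠ s : ℝ in 𝓝[>] 0, 0 < s := self_mem_nhdsWithin
  have l1 : Tendsto (fun s => Real.exp (-s) * ∫ x, corr (heat s) ψ x * χ x) (𝓝[>] 0)
      (𝓝 (∫ y, χ y * ψ y)) := by
    have he : Tendsto (fun s : ℝ => Real.exp (-s)) (𝓝[>] 0) (𝓝 1) := by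
      refine Tendsto.mono_left ?_ nhdsWithin_le_nhds
      have : Continuous fun s : ℝ => Real.exp (-s) := by fun_prop
      simpa using this.tendsto 0
    simpa using he.mul (tendsto_integral_corr_heat hψ hχ)
  have l2 : Tendsto (fun s => ∫ x, (∫ t in Set.Ioi s, Real.exp (-t) * corr (heat t) f x) * χ x)
      (𝓝[>] 0) (𝓝 (∫ x, timeIntegral (fun t => corr (heat t) f) x * χ x)) := by
    refine tendsto_integral_filter_of_dominated_convergence
      (fun x => B * √Real.pi * |χ x|) ?_ ?_ (hχ.integrable.abs.const_mul _)
      (ae_of_all _ fun x => ?_)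
    · filter_upwards [hpos] with s hs
      simp only [hrep s hs]
      refine AEStronglyMeasurable.mul ?_ hχ.integrable.aestronglyMeasurable
      have h1 := measurable_corr measurable_heat hψ.aestronglyMeasurable
      exact ((h1.comp (measurable_const.prodMk measurable_id)).const_mul
        _).neg.aestronglyMeasurable
    · filter_upwards [hpos] with s hs
      refine ae_of_all _ fun x => ?_
      rw [norm_mul, Real.norm_eq_abs, Real.norm_eq_abs]
      exact mul_le_mul_of_nonneg_right
        (abs_setIntegral_time_le hB0 (fun t ht => hB t ht x) hs.le) (abs_nonneg _)
    · refine Tendsto.mul_const _ ?_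
      have hi := integrableOn_time hm (fun t ht => hB t ht x)
      have hcov : AECover (volume.restrict (Set.Ioi (0 : ℝ))) (𝓝[>] (0 : ℝ)) Set.Ioi :=
        aecover_Ioi_of_Ioi (tendsto_id.mono_left nhdsWithin_le_nhds)
      refine (hcov.integral_tendsto_of_countably_generated hi).congr' ?_
      filter_upwards [hpos] with s hs
      rw [Measure.restrict_restrict measurableSet_Ioi,
        Set.inter_eq_left.2 (Set.Ioi_subset_Ioi (le_of_lt hs))]
  -- Duhamel's formula at time `s > 0` equates the two families, so their limits as `s → 0` agree.
  refine tendsto_nhds_unique l1 (l2.neg.congr' ?_)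
  filter_upwards [hpos] with s hs
  simp only [hrep s hs, neg_mul, integral_neg, neg_neg, mul_assoc, integral_const_mul]

/-! ### Pointwise size of the heat flow and of its time integral. -/

lemma abs_integral_mul_le_of_memLp_two {f g : Plane → ℝ} (hf : MemLp f 2 volume)
    (hg : MemLp g 2 volume) :
    |∫ y, f y * g y| ≤ √(∫ y, f y ^ 2) * (eLpNorm g 2 volume).toReal := by
  have h1 := integral_mul_norm_le_Lp_mul_Lq (p := 2) (q := 2) (μ := (volume : Measure Plane))
    Real.HolderConjugate.two_two (f := f) (g := g) (by simpa using hf) (by simpa using hg)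
  have h2 : (eLpNorm g 2 volume).toReal = (∫ y, ‖g y‖ ^ (2 : ℝ)) ^ (1 / 2 : ℝ) := by
    rw [hg.eLpNorm_eq_integral_rpow_norm (by simp) (by simp), ENNReal.toReal_ofReal (by positivity)]
    simp
  rw [h2, Real.sqrt_eq_rpow]
  have h3 : ∫ y, f y ^ 2 = ∫ y, ‖f y‖ ^ (2 : ℝ) := by simp
  rw [h3]
  refine le_trans ?_ h1
  simpa [norm_mul] using norm_integral_le_integral_norm (μ := (volume : Measure Plane))
    (fun y => f y * g y)

/-- Cauchy–Schwarz: the `L²` norm of the kernel is `(8πt)^{-1/2}`. -/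
lemma abs_corr_heat_le_of_memLp {g : Plane → ℝ} (hg : MemLp g 2 volume) {t : ℝ} (ht : 0 < t)
    (x : Plane) : |corr (heat t) g x| ≤ (eLpNorm g 2 volume).toReal * (√t)⁻¹ := by
  have h1 : MemLp (fun y => heat t (y - x)) 2 volume :=
    (memLp_heat ht).comp_measurePreserving (measurePreserving_sub_right volume x)
  have h2 := abs_integral_mul_le_of_memLp_two h1 hg
  rw [integral_sub_right_eq_self (fun y => heat t y ^ 2), integral_heat_sq ht] at h2
  refine h2.trans ?_
  rw [mul_comm, Real.sqrt_inv]
  refine mul_le_mul_of_nonneg_left (inv_anti₀ (Real.sqrt_pos.2 ht) (Real.sqrt_le_sqrt ?_))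
    ENNReal.toReal_nonneg
  nlinarith [Real.pi_gt_three]

lemma abs_corr_le_of_bounded {K w : Plane → ℝ} {A c t : ℝ} (ht : 0 < t) (hc : 0 ≤ c)
    (hK : ∀ z, |K z| ≤ c * envelope t z) (hw : ∀ᵐ y, |w y| ≤ A) (x : Plane) :
    |corr K w x| ≤ 2 * A * c := by
  have hint : Integrable (fun y => envelope t (y - x)) := (integrable_envelope ht).comp_sub_right x
  have h := norm_integral_le_of_norm_le (hint.const_mul (c * A)) (f := fun y => K (y - x) * w y)
    (by
      filter_upwards [hw] with y hy
      rw [norm_mul, Real.norm_eq_abs, Real.norm_eq_abs]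
      calc |K (y - x)| * |w y| ≤ (c * envelope t (y - x)) * A :=
            mul_le_mul (hK _) hy (abs_nonneg _) (mul_nonneg hc (envelope_nonneg ht _))
        _ = _ := by ring)
  rw [integral_const_mul, integral_sub_right_eq_self (envelope t), integral_envelope ht] at h
  rw [← Real.norm_eq_abs]
  refine h.trans (le_of_eq (by ring))

lemma tendsto_exp_neg_mul_of_bounded {v : ℝ → ℝ} {M : ℝ} (h : ∀ t, 1 ≤ t → |v t| ≤ M) :
    Tendsto (fun t => Real.exp (-t) * v t) atTop (𝓝 0) := by
  have h1 : Tendsto (fun t => Real.exp (-t) * M) atTop (𝓝 0) := by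
    simpa using Real.tendsto_exp_neg_atTop_nhds_zero.mul_const M
  refine squeeze_zero_norm' ?_ h1
  filter_upwards [eventually_ge_atTop 1] with t ht
  rw [norm_mul, Real.norm_eq_abs, Real.norm_eq_abs, Real.abs_exp]
  exact mul_le_mul_of_nonneg_left (h t ht) (Real.exp_pos _).le

/-- For `t ≥ 1` the kernel is at most 1, so it contributes at most `∫ f` against `f`, and at most
the envelope mass 2 against the constant 1. -/
lemma tendsto_corr_heat_of_dominated {ψ f : Plane → ℝ} (hf : Integrable f)
    (hf0 : ∀ y, 0 ≤ f y) (h : ∀ᵐ y, |ψ y| ≤ f y + 1) (x : Plane) :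
    Tendsto (fun t => Real.exp (-t) * corr (heat t) ψ x) atTop (𝓝 0) := by
  refine tendsto_exp_neg_mul_of_bounded (M := (∫ y, f y) + 2) fun t ht => ?_
  have ht0 : 0 < t := by linarith
  have hint : Integrable (fun y => envelope t (y - x)) :=
    (integrable_envelope ht0).comp_sub_right x
  have h1 := norm_integral_le_of_norm_le (hf.add hint) (f := fun y => heat t (y - x) * ψ y) (by
    filter_upwards [h] with y hy
    have e1 := heat_nonneg ht0 (y - x)
    have e2 := (le_abs_self _).trans (abs_heat_le ht0 (y - x))
    have e3 : heat t (y - x) ≤ 1 := by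
      refine mul_le_one₀ (inv_le_one_of_one_le₀ ?_) (Real.exp_pos _).le ?_
      · nlinarith [Real.pi_gt_three]
      · rw [Real.exp_le_one_iff]
        have : 0 ≤ (4 * t)⁻¹ * ‖y - x‖ ^ 2 := by positivity
        linarith
    rw [norm_mul, Real.norm_eq_abs, Real.norm_eq_abs, abs_of_nonneg e1, Pi.add_apply]
    calc heat t (y - x) * |ψ y| ≤ heat t (y - x) * (f y + 1) := mul_le_mul_of_nonneg_left hy e1
      _ ≤ f y + envelope t (y - x) := by nlinarith [mul_le_mul_of_nonneg_right e3 (hf0 y)])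
  rw [integral_add' hf hint, integral_sub_right_eq_self (envelope t), integral_envelope ht0] at h1
  exact h1

lemma abs_timeIntegral_le {H : ℝ → Plane → ℝ} {B : ℝ} {x : Plane} (hB0 : 0 ≤ B)
    (hB : ∀ t, 0 < t → |H t x| ≤ B * (√t)⁻¹) : |timeIntegral H x| ≤ 2 * B := by
  refine (abs_setIntegral_time_le hB0 hB le_rfl).trans ?_
  have : √Real.pi ≤ 2 := Real.sqrt_le_iff.2 ⟨by norm_num, by linarith [Real.pi_le_four]⟩
  nlinarith

/-- The logarithmic estimate, by splitting the time integral. -/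
lemma abs_timeIntegral_le_log {H : ℝ → Plane → ℝ}
    (hH : Measurable (fun p : ℝ × Plane => H p.1 p.2)) {N A : ℝ} {x : Plane}
    (hN0 : 0 ≤ N) (hA0 : 0 ≤ A)
    (hN : ∀ t, 0 < t → |H t x| ≤ N * (√t)⁻¹) (hA : ∀ t, 0 < t → |H t x| ≤ A * t⁻¹) :
    |timeIntegral H x| ≤ 2 + A * (1 + 2 * Real.posLog N) := by
  -- The cut `ε = m⁻²` makes `N √ε ≤ 1`, while `log (1 / ε) = 2 log m = 2 ln⁺ N`.
  set m := max 1 N with hm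
  have hm1 : 1 ≤ m := le_max_left _ _
  have hm0 : 0 < m := by linarith
  have hNm : N ≤ m := le_max_right _ _
  set ε := (m ^ 2)⁻¹ with hε
  have hε0 : 0 < ε := by positivity
  have hε1 : ε ≤ 1 := inv_le_one_of_one_le₀ (one_le_pow₀ hm1)
  have hsε : √ε = m⁻¹ := by
    rw [hε, Real.sqrt_inv, Real.sqrt_sq hm0.le]
  have hint := integrableOn_time hH hN
  set F : ℝ → ℝ := fun t => Real.exp (-t) * H t x with hF
  have i1 : IntegrableOn F (Set.Ioc 0 ε) := hint.mono_set Set.Ioc_subset_Ioi_self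
  have i2 : IntegrableOn F (Set.Ioc ε 1) := hint.mono_set fun t ht => lt_trans hε0 ht.1
  have i3 : IntegrableOn F (Set.Ioi 1) := hint.mono_set (Set.Ioi_subset_Ioi zero_le_one)
  have hsplit : timeIntegral H x =
      (∫ t in Set.Ioc 0 ε, F t) + (∫ t in Set.Ioc ε 1, F t) + ∫ t in Set.Ioi 1, F t := by
    rw [timeIntegral, ← Set.Ioc_union_Ioi_eq_Ioi zero_le_one,
      setIntegral_union (Set.Ioc_disjoint_Ioi le_rfl) measurableSet_Ioi
        (hint.mono_set Set.Ioc_subset_Ioi_self) i3,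
      ← Set.Ioc_union_Ioc_eq_Ioc hε0.le hε1,
      setIntegral_union (Set.Ioc_disjoint_Ioc_of_le le_rfl) measurableSet_Ioc i1 i2]
  have hexp : ∀ t : ℝ, 0 < t → Real.exp (-t) ≤ 1 := fun t ht => by
    rw [Real.exp_le_one_iff]; linarith
  -- Short times use the `N` bound: `∫₀^ε N t^{-1/2} dt = 2 N √ε`.
  have b1 : |∫ t in Set.Ioc 0 ε, F t| ≤ 2 := by
    have hg : IntervalIntegrable (fun t : ℝ => N * t ^ (-(1 / 2) : ℝ)) volume 0 ε :=
      (intervalIntegral.intervalIntegrable_rpow' (by norm_num)).const_mul N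
    have h1 := norm_integral_le_of_norm_le
      ((intervalIntegrable_iff_integrableOn_Ioc_of_le hε0.le).1 hg) (f := F) (by
      filter_upwards [ae_restrict_mem measurableSet_Ioc] with t ht
      rw [norm_mul, Real.norm_eq_abs, Real.abs_exp, Real.norm_eq_abs, Real.rpow_neg ht.1.le,
        ← Real.sqrt_eq_rpow]
      exact (mul_le_of_le_one_left (abs_nonneg _) (hexp t ht.1)).trans (hN t ht.1))
    rw [← intervalIntegral.integral_of_le (f := fun t : ℝ => N * t ^ (-(1 / 2) : ℝ)) hε0.le,
      intervalIntegral.integral_const_mul,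
      integral_rpow (Or.inl (by norm_num))] at h1
    norm_num at h1
    rw [← Real.norm_eq_abs]
    refine h1.trans ?_
    rw [← Real.sqrt_eq_rpow, hsε]
    have : N * m⁻¹ ≤ 1 := by
      rw [← div_eq_mul_inv, div_le_one hm0]; exact hNm
    linarith
  -- Intermediate times use the `A` bound and produce the logarithm.
  have b2 : |∫ t in Set.Ioc ε 1, F t| ≤ A * (2 * Real.posLog N) := by
    have hg : IntervalIntegrable (fun t : ℝ => A * t⁻¹) volume ε 1 :=
      (intervalIntegral.intervalIntegrable_inv (fun t ht => by
        rw [Set.uIcc_of_le hε1] at ht; exact (hε0.trans_le ht.1).ne') continuousOn_id).const_mul A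
    have h1 := norm_integral_le_of_norm_le
      ((intervalIntegrable_iff_integrableOn_Ioc_of_le hε1).1 hg) (f := F) (by
      filter_upwards [ae_restrict_mem measurableSet_Ioc] with t ht
      have ht0 : 0 < t := hε0.trans ht.1
      rw [norm_mul, Real.norm_eq_abs, Real.abs_exp, Real.norm_eq_abs]
      exact (mul_le_of_le_one_left (abs_nonneg _) (hexp t ht0)).trans (hA t ht0))
    rw [← intervalIntegral.integral_of_le (f := fun t : ℝ => A * t⁻¹) hε1,
      intervalIntegral.integral_const_mul,
      integral_inv_of_pos hε0 one_pos] at h1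
    rw [← Real.norm_eq_abs, Real.posLog_eq_log_max_one hN0, ← hm]
    refine h1.trans (le_of_eq ?_)
    rw [hε, one_div, inv_inv, Real.log_pow]
    norm_num
  -- For `t > 1` the factor `t⁻¹` is at most 1 and `e^{-t}` gives convergence.
  have b3 : |∫ t in Set.Ioi 1, F t| ≤ A := by
    have hg : IntegrableOn (fun t : ℝ => A * Real.exp (-t)) (Set.Ioi 1) :=
      (integrableOn_exp_neg_Ioi 1).const_mul A
    have h1 := norm_integral_le_of_norm_le hg (f := F) (by
      filter_upwards [ae_restrict_mem measurableSet_Ioi] with t ht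
      have ht1 : 1 < t := ht
      rw [norm_mul, Real.norm_eq_abs, Real.abs_exp, Real.norm_eq_abs, mul_comm]
      refine mul_le_mul_of_nonneg_right ((hA t (by linarith)).trans ?_) (Real.exp_pos _).le
      exact mul_le_of_le_one_right hA0 (inv_le_one_of_one_le₀ ht1.le))
    rw [integral_const_mul, integral_exp_neg_Ioi] at h1
    rw [← Real.norm_eq_abs]
    exact h1.trans (mul_le_of_le_one_right hA0 (hexp 1 one_pos))
  rw [hsplit]
  have := (abs_add_le (∫ t in Set.Ioc 0 ε, F t) (∫ t in Set.Ioc ε 1, F t))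
  have := abs_add_le ((∫ t in Set.Ioc 0 ε, F t) + (∫ t in Set.Ioc ε 1, F t))
    (∫ t in Set.Ioi 1, F t)
  linarith

/-! ### Moving derivatives between test function, kernel and source. -/

lemma integral_timeIntegral_mul_partialDeriv {K K' : ℝ → Plane → ℝ} {w φ : Plane → ℝ}
    (i : Fin 2) (hK : Measurable (fun p : ℝ × Plane => K p.1 p.2))
    (hK' : Measurable (fun p : ℝ × Plane => K' p.1 p.2))
    (hg : ∀ t, 0 < t → GaussBdd (K t)) (hg' : ∀ t, 0 < t → GaussBdd (K' t))
    (hc : ∀ t, ContDiff ℝ ∞ (K t)) (hKK' : ∀ t, partialDeriv i (K t) = K' t)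
    (hw : Tame w) {B B' : ℝ}
    (hB : ∀ t, 0 < t → ∀ x, |corr (K t) w x| ≤ B * (√t)⁻¹)
    (hB' : ∀ t, 0 < t → ∀ x, |corr (K' t) w x| ≤ B' * (√t)⁻¹) (hφ : IsTest φ) :
    ∫ x, timeIntegral (fun t => corr (K t) w) x * partialDeriv i φ x =
      ∫ x, timeIntegral (fun t => corr (K' t) w) x * φ x := by
  rw [integral_timeIntegral_mul (measurable_corr hK hw.aestronglyMeasurable) hB
      (hφ.partialDeriv i).integrable,
    integral_timeIntegral_mul (measurable_corr hK' hw.aestronglyMeasurable) hB' hφ.integrable]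
  refine setIntegral_congr_fun measurableSet_Ioi fun t ht => congrArg _ ?_
  rw [integral_corr_mul_partialDeriv (hg t ht) (hc t) i (by rw [hKK']; exact hg' t ht) hw hφ, hKK']

lemma heatSnd_comm (i j : Fin 2) (t : ℝ) : heatSnd i j t = heatSnd j i t := by
  ext z
  simp only [heatSnd, eq_comm (a := i), mul_comm (z i)]

/-- The kernel is a legitimate test function for the weak derivative `g = ∂ᵢ∂ⱼ w`; an even number of
derivatives leaves no sign. This exchanges the `t⁻¹` singularity for the `L²` norm of `g`. -/
lemma corr_heatSnd_eq {w g : Plane → ℝ} {i j : Fin 2} (hw : Tame w) (hg : Tame g)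
    (h : ∀ φ, IsTest φ → ∫ y, partialDeriv i (partialDeriv j φ) y * w y = ∫ y, φ y * g y)
    {t : ℝ} (ht : 0 < t) (x : Plane) :
    corr (heatSnd i j t) w x = corr (heat t) g x := by
  let a : Fin 2 → Fin 2 → ℝ := fun k l => if k = i ∧ l = j then 1 else 0
  have ha (f : Plane → ℝ) : secondOrder a 0 f = partialDeriv i (partialDeriv j f) := by
    ext y
    fin_cases i <;> fin_cases j <;> simp [secondOrder, a, Fin.sum_univ_two]
  have := (smoothGauss_heat ht x).integral_secondOrder hw hg a 0 (fun φ hφ => by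
    rw [ha]; exact h φ hφ)
  rw [ha] at this
  rw [corr, corr, ← this, partialDeriv_comp_sub, partialDeriv_heat, partialDeriv_comp_sub,
    partialDeriv_heatFst, heatSnd_comm]

/-! ### Weak derivatives and Sobolev norms. -/

section WeakDerivatives

variable {F : Type*} [NormedAddCommGroup F] [NormedSpace ℝ F] [CompleteSpace F]

lemma IsWeakDeriv.weakDeriv_ae_eq {β : ℕ × ℕ} {f g : Plane → F} (h : IsWeakDeriv β f g) :
    weakDeriv β f =ᵐ[volume] g := by
  have hex : ∃ g, IsWeakDeriv β f g := ⟨g, h⟩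
  have hw : IsWeakDeriv β f (weakDeriv β f) := by
    rw [weakDeriv, dif_pos hex]
    exact hex.choose_spec
  refine ae_eq_of_integral_contDiff_smul_eq hw.2.1 h.2.1 fun φ h1 h2 => ?_
  have h3 := (hw.2.2 φ ⟨h1, h2⟩).symm.trans (h.2.2 φ ⟨h1, h2⟩)
  exact smul_right_injective F (pow_ne_zero _ (by norm_num : (-1 : ℝ) ≠ 0)) h3

lemma IsWeakDeriv.toReal_eLpNorm_le_sobolevNorm {k : ℕ} {β : ℕ × ℕ} {f g : Plane → F}
    (hf : MemSobolev k 2 f) (hβ : β ∈ multiIndices k) (h : IsWeakDeriv β f g) :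
    (eLpNorm g 2 volume).toReal ≤ sobolevNorm k 2 f := by
  rw [← eLpNorm_congr_ae h.weakDeriv_ae_eq, sobolevNorm, if_neg (by simp)]
  -- Finiteness of every term is essential, since `toReal` sends `⊤` to 0.
  have hfin : ∀ γ ∈ multiIndices k, eLpNorm (weakDeriv γ f) 2 volume ^ (2 : ℝ≥0∞).toReal ≠ ⊤ := by
    intro γ hγ
    obtain ⟨g', h1, h2⟩ := hf γ hγ
    rw [eLpNorm_congr_ae h1.weakDeriv_ae_eq]
    exact ENNReal.rpow_ne_top_of_nonneg (by simp) h2.2.ne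
  refine ENNReal.toReal_mono
    (ENNReal.rpow_ne_top_of_nonneg (by simp) (ENNReal.sum_ne_top.2 hfin)) ?_
  have h1 := Finset.single_le_sum (f := fun γ =>
    eLpNorm (weakDeriv γ f) 2 volume ^ (2 : ℝ≥0∞).toReal) (fun _ _ => zero_le) hβ
  refine le_trans (le_of_eq ?_) (ENNReal.rpow_le_rpow h1 (z := 1 / (2 : ℝ≥0∞).toReal) (by simp))
  rw [← ENNReal.rpow_mul]
  simp

lemma memSobolev_top_and_norm_le {k : ℕ} {f : Plane → F} {M : ℝ} (hM : 0 ≤ M)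
    (h : ∀ β ∈ multiIndices k, ∃ g, IsWeakDeriv β f g ∧ ∀ᵐ x, ‖g x‖ ≤ M) :
    MemSobolev k ⊤ f ∧ sobolevNorm k ⊤ f ≤ M := by
  refine ⟨fun β hβ => ?_, ?_⟩
  · obtain ⟨g, h1, h2⟩ := h β hβ
    exact ⟨g, h1, memLp_top_of_bound h1.2.1.aestronglyMeasurable M h2⟩
  · rw [sobolevNorm, if_pos rfl]
    refine ENNReal.toReal_le_of_le_ofReal hM (Finset.sup_le fun β hβ => ?_)
    obtain ⟨g, h1, h2⟩ := h β hβ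
    rw [eLpNorm_congr_ae h1.weakDeriv_ae_eq, eLpNorm_exponent_top]
    exact eLpNormEssSup_le_of_ae_bound h2

end WeakDerivatives

lemma locallyIntegrable_of_bounded {g : Plane → ℝ} (hm : Measurable g) {M : ℝ}
    (h : ∀ x, |g x| ≤ M) : LocallyIntegrable g volume :=
  (memLp_top_of_bound hm.aestronglyMeasurable M (ae_of_all _ h)).locallyIntegrable le_top

lemma locallyIntegrable_of_coord {u : Plane → Plane}
    (h : ∀ i, LocallyIntegrable (fun x => u x i) volume) : LocallyIntegrable u volume := by
  refine (locallyIntegrable_iff (μ := volume)).2 fun K hK => ?_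
  exact Integrable.of_eval_piLp fun i => (h i).integrableOn_isCompact hK

lemma isTest_multiDeriv {φ : Plane → ℝ} (hφ : IsTest φ) (β : ℕ × ℕ) :
    IsTest (multiDeriv β φ) := by
  have h (i : Fin 2) (n : ℕ) : ∀ φ : Plane → ℝ, IsTest φ → IsTest ((partialDeriv i)^[n] φ) := by
    induction n with
    | zero => exact fun φ h => h
    | succ n ih => exact fun φ h => ih _ (h.partialDeriv i)
  exact h 0 _ _ (h 1 _ _ hφ)

lemma IsTest.integrable_smul {φ : Plane → ℝ} (hφ : IsTest φ) {g : Plane → ℝ}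
    (hg : LocallyIntegrable g volume) : Integrable (fun x => φ x • g x) :=
  hg.integrable_smul_left_of_hasCompactSupport hφ.1.continuous hφ.2

lemma isWeakDeriv_of_coord {β : ℕ × ℕ} {u g : Plane → Plane}
    (h : ∀ i, IsWeakDeriv β (fun x => u x i) (fun x => g x i)) : IsWeakDeriv β u g := by
  refine ⟨locallyIntegrable_of_coord fun i => (h i).1,
    locallyIntegrable_of_coord fun i => (h i).2.1, fun φ hφ => ?_⟩
  ext i
  have e1 := eval_integral_piLp (f := fun x => multiDeriv β φ x • u x)
    (fun j => (isTest_multiDeriv hφ β).integrable_smul (h j).1) i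
  have e2 := eval_integral_piLp (f := fun x => φ x • g x)
    (fun j => hφ.integrable_smul (h j).2.1) i
  rw [e1, PiLp.smul_apply, e2]
  exact (h i).2.2 φ hφ

lemma norm_plane_le (v : Plane) : ‖v‖ ≤ |v 0| + |v 1| := by
  rw [EuclideanSpace.norm_eq, Fin.sum_univ_two, Real.sqrt_le_left (by positivity)]
  simp only [Real.norm_eq_abs]
  nlinarith [abs_nonneg (v 0), abs_nonneg (v 1)]

/-! ### Boundedness of the source and of the velocity. -/

/-- The weak second derivatives of a function in `W^{2,2}`. -/
lemma MemSobolev.exists_second {w : Plane → ℝ} (hw : MemSobolev 2 2 w) (i : Fin 2) (j : Fin 2)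
    (hij : i ≤ j) :
    ∃ g, MemLp g 2 volume ∧ (eLpNorm g 2 volume).toReal ≤ sobolevNorm 2 2 w ∧
      ∀ φ, IsTest φ → ∫ y, partialDeriv i (partialDeriv j φ) y * w y = ∫ y, φ y * g y := by
  -- `multiDeriv` applies `∂₁` outside `∂₂`, so only ordered pairs match a multi-index
  -- definitionally; the remaining mixed case is later covered by symmetry of `heatSnd`.
  have key (β : ℕ × ℕ) (hβ : β ∈ multiIndices 2) (h2 : β.1 + β.2 = 2)
      (hd : multiDeriv β = fun φ => partialDeriv i (partialDeriv j φ)) :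
      ∃ g, MemLp g 2 volume ∧ (eLpNorm g 2 volume).toReal ≤ sobolevNorm 2 2 w ∧
      ∀ φ, IsTest φ → ∫ y, partialDeriv i (partialDeriv j φ) y * w y = ∫ y, φ y * g y := by
    obtain ⟨g, h3, h4⟩ := hw β hβ
    refine ⟨g, h4, h3.toReal_eLpNorm_le_sobolevNorm hw hβ, fun φ hφ => ?_⟩
    have := h3.2.2 φ hφ
    rw [hd, h2] at this
    simpa using this
  fin_cases i <;> fin_cases j
  · exact key (2, 0) (by simp [multiIndices]) rfl rfl
  · exact key (1, 1) (by simp [multiIndices]) rfl rfl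
  · simp at hij
  · exact key (0, 2) (by simp [multiIndices]) rfl rfl

lemma MemSobolev.memLp_two {w : Plane → ℝ} (hw : MemSobolev 2 2 w) : MemLp w 2 volume := by
  obtain ⟨g, h1, h2⟩ := hw (0, 0) (by simp [multiIndices])
  refine h2.ae_eq (ae_eq_of_integral_contDiff_smul_eq h1.2.1 h1.1 fun φ h3 h4 => ?_)
  simpa [multiDeriv] using (h1.2.2 φ ⟨h3, h4⟩).symm

/-- A Sobolev embedding by the same representation: `w` is itself a weak solution with source `f =
Δw - w` in `L²`, whence `|w| ≤ 2 ‖f‖₂` almost everywhere. -/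
lemma MemSobolev.memLp_top {w : Plane → ℝ} (hw : MemSobolev 2 2 w) : MemLp w ⊤ volume := by
  have hw2 := hw.memLp_two
  have hwt := tame_of_memLp hw2
  obtain ⟨g0, hg0, -, h0⟩ := hw.exists_second 0 0 le_rfl
  obtain ⟨g1, hg1, -, h1⟩ := hw.exists_second 1 1 le_rfl
  let f : Plane → ℝ := fun y => g0 y + g1 y - w y
  have hf : MemLp f 2 volume := (hg0.add hg1).sub hw2
  have hft := tame_of_memLp hf
  have hB := fun t ht x => abs_corr_heat_le_of_memLp hf (t := t) ht x
  have heq : ∀ φ, IsTest φ →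
      ∫ y, secondOrder laplaceCoeff (-1) φ y * w y = ∫ y, φ y * f y := by
    intro φ hφ
    have hi {ψ g : Plane → ℝ} (hψ : IsTest ψ) (hg : MemLp g 2 volume) :
        Integrable (fun y => ψ y * g y) :=
      hψ.integrable_smul (hg.locallyIntegrable one_le_two)
    have e1 : ∫ y, φ y * f y = (∫ y, φ y * g0 y) + (∫ y, φ y * g1 y) - ∫ y, φ y * w y := by
      rw [← integral_add (hi hφ hg0) (hi hφ hg1),
        ← integral_sub ((hi hφ hg0).fun_add (hi hφ hg1)) (hi hφ hw2)]
      refine integral_congr_ae (ae_of_all _ fun y => ?_)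
      simp only [f]
      ring
    have i0 := hi ((hφ.partialDeriv 0).partialDeriv 0) hw2
    have i1 := hi ((hφ.partialDeriv 1).partialDeriv 1) hw2
    rw [e1, ← h0 φ hφ, ← h1 φ hφ, ← integral_add i0 i1, ← integral_sub (i0.fun_add i1) (hi hφ hw2)]
    refine integral_congr_ae (ae_of_all _ fun y => ?_)
    simp only [secondOrder_laplaceCoeff]
    ring
  have hdecay : ∀ x, Tendsto (fun t => Real.exp (-t) * corr (heat t) w x) atTop (𝓝 0) :=
    fun x => tendsto_exp_neg_mul_of_bounded fun t ht =>
      (abs_corr_heat_le_of_memLp hw2 (by linarith) x).trans (mul_le_of_le_one_right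
        ENNReal.toReal_nonneg (inv_le_one_of_one_le₀ (Real.one_le_sqrt.2 ht)))
  have hm := measurable_timeIntegral (H := fun t => corr (heat t) f)
    (measurable_corr measurable_heat hft.aestronglyMeasurable)
  have hS := fun x => abs_timeIntegral_le (H := fun t => corr (heat t) f)
    ENNReal.toReal_nonneg (fun t ht => hB t ht x)
  have hae : ∀ᵐ x, w x = -timeIntegral (fun t => corr (heat t) f) x := by
    refine ae_eq_of_integral_contDiff_smul_eq (hw2.locallyIntegrable one_le_two)
      (locallyIntegrable_of_bounded hm hS).neg fun φ h3 h4 => ?_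
    have := integral_mul_eq_neg_timeIntegral hwt hft heq ENNReal.toReal_nonneg hB hdecay ⟨h3, h4⟩
    simp only [smul_eq_mul]
    rw [this, ← integral_neg]
    refine integral_congr_ae (ae_of_all _ fun y => ?_)
    simp only []
    ring
  refine memLp_top_of_bound hw2.1 (2 * (eLpNorm f 2 volume).toReal) ?_
  filter_upwards [hae] with x hx
  rw [hx, norm_neg]
  exact hS x

lemma IsSolution.secondOrder_eq {w ψ : Plane → ℝ} (h : IsSolution w ψ) (φ : Plane → ℝ)
    (hφ : IsTest φ) :
    ∫ y, secondOrder laplaceCoeff (-1) φ y * ψ y = ∫ y, φ y * w y := by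
  have := h.equation φ hφ
  simp only [mul_comm (w _)] at this
  rw [← this]
  refine integral_congr_ae (ae_of_all _ fun y => ?_)
  simp only [secondOrder_laplaceCoeff, laplacian_eq hφ.1]
  ring

/-- The representation of `ψ` is tested with `∂ᵢφ`, and the derivative is moved onto the kernel. It
identifies the weak derivative `∂ᵢψ` as the time integral against `heatFst i`. -/
lemma integral_partialDeriv_mul_eq {w ψ : Plane → ℝ} (hw : MemSobolev 2 2 w)
    (hψ : IsSolution w ψ) {A : ℝ} (hA : ∀ᵐ y, |w y| ≤ A) (i : Fin 2) {φ : Plane → ℝ}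
    (hφ : IsTest φ) :
    ∫ y, partialDeriv i φ y * ψ y =
      -∫ x, timeIntegral (fun t => corr (heatFst i t) w) x * φ x := by
  have hw2 := hw.memLp_two
  have hwt := tame_of_memLp hw2
  obtain ⟨f, hf, hf0, hfψ⟩ := exists_dominating hψ.locallyIntegrable hψ.tendsto_zero
  have hψt := tame_of_dominated hψ.locallyIntegrable.aestronglyMeasurable hf hfψ
  have hB := fun t ht x => abs_corr_heat_le_of_memLp hw2 (t := t) ht x
  rw [integral_mul_eq_neg_timeIntegral hψt hwt hψ.secondOrder_eq ENNReal.toReal_nonneg hB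
    (tendsto_corr_heat_of_dominated hf hf0 hfψ) (hφ.partialDeriv i),
    integral_timeIntegral_mul_partialDeriv i measurable_heat (measurable_heatFst i)
      (fun t ht => gaussBdd_heat ht) (fun t ht => gaussBdd_heatFst i ht) contDiff_heat
      (partialDeriv_heat i) hwt hB (fun t ht x => abs_corr_le_of_bounded ht (by positivity)
        (abs_heatFst_le i ht) hA x) hφ]

/-- The velocity of a decaying solution has bounded weak derivatives up to order one. -/
lemma exists_weakDeriv_perpGradient {w ψ : Plane → ℝ} {u : Plane → Plane}
    (hw : MemSobolev 2 2 w) (hψ : IsSolution w ψ) (hu : IsWeakPerpGradient ψ u)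
    {A : ℝ} (hA0 : 0 ≤ A) (hA : ∀ᵐ y, |w y| ≤ A) (β : ℕ × ℕ) (hβ : β ∈ multiIndices 1) :
    ∃ g, IsWeakDeriv β u g ∧
      ∀ᵐ x, ‖g x‖ ≤ 8 * (1 + (1 + 2 * Real.posLog (sobolevNorm 2 2 w)) * A) := by
  have hL : 0 ≤ Real.posLog (sobolevNorm 2 2 w) := Real.posLog_nonneg
  have hN0 : 0 ≤ sobolevNorm 2 2 w := ENNReal.toReal_nonneg
  set N := sobolevNorm 2 2 w
  have hwt := tame_of_memLp hw.memLp_two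
  have hwm := hwt.aestronglyMeasurable
  let S : Fin 2 → Plane → ℝ := fun i => timeIntegral (fun t => corr (heatFst i t) w)
  let S2 : Fin 2 → Fin 2 → Plane → ℝ := fun i j => timeIntegral (fun t => corr (heatSnd i j t) w)
  have hB1 : ∀ i t, 0 < t → ∀ x, |corr (heatFst i t) w x| ≤ 2 * A * (√t)⁻¹ := fun i t ht x =>
    abs_corr_le_of_bounded ht (by positivity) (abs_heatFst_le i ht) hA x
  have hB2 : ∀ i j t, 0 < t → ∀ x, |corr (heatSnd i j t) w x| ≤ N * (√t)⁻¹ := by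
    have key : ∀ i j, i ≤ j → ∀ t, 0 < t → ∀ x, |corr (heatSnd i j t) w x| ≤ N * (√t)⁻¹ := by
      intro i j hij t ht x
      obtain ⟨g, hg, hgN, h⟩ := hw.exists_second i j hij
      rw [corr_heatSnd_eq hwt (tame_of_memLp hg) h ht]
      exact (abs_corr_heat_le_of_memLp hg ht x).trans
        (mul_le_mul_of_nonneg_right hgN (by positivity))
    intro i j t ht x
    rcases le_total i j with hij | hij
    · exact key i j hij t ht x
    · rw [heatSnd_comm]
      exact key j i hij t ht x
  have hA2 : ∀ i j t, 0 < t → ∀ x, |corr (heatSnd i j t) w x| ≤ 4 * A * t⁻¹ := fun i j t ht x =>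
    (abs_corr_le_of_bounded ht (by positivity) (abs_heatSnd_le i j ht) hA x).trans
      (le_of_eq (by ring))
  have hSm i : Measurable (S i) :=
    measurable_timeIntegral (measurable_corr (measurable_heatFst i) hwm)
  have hS2m i j : Measurable (S2 i j) :=
    measurable_timeIntegral (measurable_corr (measurable_heatSnd i j) hwm)
  have hSb i x : |S i x| ≤ 2 * (2 * A) :=
    abs_timeIntegral_le (by positivity) fun t ht => hB1 i t ht x
  have hS2b i j x : |S2 i j x| ≤ 2 + 4 * A * (1 + 2 * Real.posLog N) :=
    abs_timeIntegral_le_log (measurable_corr (measurable_heatSnd i j) hwm) hN0 (by positivity)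
      (fun t ht => hB2 i j t ht x) (fun t ht => hA2 i j t ht x)
  have hparts i j φ (hφ : IsTest φ) :
      ∫ x, S i x * partialDeriv j φ x = ∫ x, S2 i j x * φ x :=
    integral_timeIntegral_mul_partialDeriv j (measurable_heatFst i) (measurable_heatSnd i j)
      (fun t ht => gaussBdd_heatFst i ht) (fun t ht => gaussBdd_heatSnd i j ht)
      (contDiff_heatFst i) (partialDeriv_heatFst i j) hwt (hB1 i) (hB2 i j) hφ
  -- Here `S i` represents `∂ᵢψ` and `-S2 i j` its `j`-th derivative, so `T` represents `u` and `G
  -- j` represents `∂ⱼu`.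
  let T : Fin 2 → Plane → ℝ := ![fun x => -S 1 x, S 0]
  let G : Fin 2 → Fin 2 → Plane → ℝ := fun j => ![S2 1 j, fun x => -S2 0 j x]
  have hu0 : LocallyIntegrable (fun x => u x 0) volume := by
    have h : (fun x => u x 0) = -(fun x => -(u x 0)) := by ext x; simp
    rw [h]
    exact hu.1.2.1.neg
  have hul : ∀ i, LocallyIntegrable (fun x => u x i) volume := by
    intro i
    fin_cases i
    exacts [hu0, hu.2.2.1]
  have hTl : ∀ i, LocallyIntegrable (T i) volume := by
    intro i
    fin_cases i
    · exact (locallyIntegrable_of_bounded (hSm 1) (hSb 1)).neg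
    · exact locallyIntegrable_of_bounded (hSm 0) (hSb 0)
  have huT : ∀ i, (fun x => u x i) =ᵐ[volume] T i := by
    intro i
    refine ae_eq_of_integral_contDiff_smul_eq (hul i) (hTl i) fun φ h1 h2 => ?_
    have hφ : IsTest φ := ⟨h1, h2⟩
    fin_cases i
    · have e1 := hu.1.2.2 φ hφ
      have e2 := integral_partialDeriv_mul_eq hw hψ hA 1 hφ
      simp only [multiDeriv, smul_eq_mul, Function.iterate_zero, id_eq, Function.iterate_one,
        zero_add, pow_one, mul_neg, integral_neg, neg_mul, one_mul, neg_neg] at e1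
      simp only [T, S, smul_eq_mul, Fin.zero_eta, Matrix.cons_val_zero, mul_neg, integral_neg]
      rw [← e1, e2]
      simp only [mul_comm]
    · have e1 := hu.2.2.2 φ hφ
      have e2 := integral_partialDeriv_mul_eq hw hψ hA 0 hφ
      simp only [multiDeriv, smul_eq_mul, Function.iterate_zero, id_eq, Function.iterate_one,
        add_zero, pow_one, neg_mul, one_mul] at e1
      simp only [T, S, smul_eq_mul, Fin.mk_one, Matrix.cons_val_one, Matrix.cons_val_fin_one]
      rw [e2, neg_inj] at e1
      rw [← e1]
      simp only [mul_comm]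
  have hGl : ∀ j i, LocallyIntegrable (G j i) volume := by
    intro j i
    fin_cases i
    · exact locallyIntegrable_of_bounded (hS2m 1 j) (hS2b 1 j)
    · exact (locallyIntegrable_of_bounded (hS2m 0 j) (hS2b 0 j)).neg
  have hTG : ∀ i j φ, IsTest φ → ∫ x, partialDeriv j φ x * T i x = -∫ x, φ x * G j i x := by
    intro i j φ hφ
    fin_cases i
    · simp only [T, G, Fin.zero_eta, Matrix.cons_val_zero, mul_neg, integral_neg, neg_inj]
      simpa only [mul_comm] using hparts 1 j φ hφ
    · simp only [T, G, Fin.mk_one, Matrix.cons_val_one, Matrix.cons_val_fin_one, mul_neg,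
        integral_neg, neg_neg]
      simpa only [mul_comm] using hparts 0 j φ hφ
  have hGb : ∀ j i x, |G j i x| ≤ 2 + 4 * A * (1 + 2 * Real.posLog N) := by
    intro j i x
    fin_cases i
    · exact hS2b 1 j x
    · simpa [G] using hS2b 0 j x
  have hfirst : ∀ (γ : ℕ × ℕ) (j : Fin 2), γ.1 + γ.2 = 1 → multiDeriv γ = partialDeriv j →
      ∃ g, IsWeakDeriv γ u g ∧ ∀ᵐ x, ‖g x‖ ≤ 8 * (1 + (1 + 2 * Real.posLog N) * A) := by
    intro γ j hγ hd
    refine ⟨fun x => WithLp.toLp 2 (fun i => G j i x), isWeakDeriv_of_coord fun i =>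
      ⟨hul i, hGl j i, fun φ hφ => ?_⟩, ae_of_all _ fun x => ?_⟩
    · rw [hd, hγ]
      simp only [smul_eq_mul, pow_one, neg_mul, one_mul]
      rw [← hTG i j φ hφ]
      refine integral_congr_ae ?_
      filter_upwards [huT i] with x hx
      rw [hx]
    -- Two components, each at most `2 + 4A(1 + 2 ln⁺ N)`, sum to `4 + 8A(1 + 2 ln⁺ N)`; this is
    -- where the constant 8 comes from.
    · refine (norm_plane_le _).trans ?_
      have h0 := hGb j 0 x
      have h1 := hGb j 1 x
      simp only []
      nlinarith
  obtain ⟨a, b⟩ := β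
  have hab : a + b ≤ 1 := (Finset.mem_filter.1 hβ).2
  obtain ⟨rfl, rfl⟩ | ⟨rfl, rfl⟩ | ⟨rfl, rfl⟩ :
      (a = 0 ∧ b = 0) ∨ (a = 1 ∧ b = 0) ∨ (a = 0 ∧ b = 1) := by omega
  · refine ⟨u, isWeakDeriv_of_coord fun i => ⟨hul i, hul i, fun φ hφ => by simp [multiDeriv]⟩, ?_⟩
    filter_upwards [huT 0, huT 1] with x h0 h1
    refine (norm_plane_le _).trans ?_
    rw [h0, h1]
    have e0 : |T 0 x| ≤ 2 * (2 * A) := by simpa [T] using hSb 1 x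
    have e1 : |T 1 x| ≤ 2 * (2 * A) := hSb 0 x
    -- At order zero each component is at most `4A`, so the sum `8A` fits the same constant.
    nlinarith [mul_nonneg hL hA0]
  · exact hfirst (1, 0) 0 rfl rfl
  · exact hfirst (0, 1) 1 rfl rfl

end ScreenedPoisson

open ScreenedPoisson in
theorem proposition1 :
    ∃ C : ℝ, 0 < C ∧
      ∀ (w ψ : ScreenedPoisson.Plane → ℝ) (u : ScreenedPoisson.Plane → ScreenedPoisson.Plane),
        ScreenedPoisson.MemSobolev 2 2 w →
        ScreenedPoisson.IsSolution w ψ →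
        ScreenedPoisson.IsWeakPerpGradient ψ u →
          MemLp w ⊤ volume ∧
          ScreenedPoisson.MemSobolev 1 ⊤ u ∧
          ScreenedPoisson.sobolevNorm 1 ⊤ u ≤
            C * (1 + (1 + 2 * Real.posLog (ScreenedPoisson.sobolevNorm 2 2 w)) *
              (eLpNorm w ⊤ volume).toReal) := by
  refine ⟨8, by norm_num, fun w ψ u hw hψ hu => ⟨hw.memLp_top, ?_⟩⟩
  have hA0 : 0 ≤ (eLpNorm w ⊤ volume).toReal := ENNReal.toReal_nonneg
  have hA : ∀ᵐ y, |w y| ≤ (eLpNorm w ⊤ volume).toReal := by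
    filter_upwards [ae_le_eLpNormEssSup (f := w) (μ := volume)] with y hy
    rw [← eLpNorm_exponent_top] at hy
    simpa using ENNReal.toReal_mono hw.memLp_top.2.ne hy
  have hL : 0 ≤ Real.posLog (sobolevNorm 2 2 w) := Real.posLog_nonneg
  exact memSobolev_top_and_norm_le (by positivity)
    (exists_weakDeriv_perpGradient hw hψ hu hA0 hA)
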